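/- Let $n\ge 1$. On $\mathbb R^{n+1}$ let $x\circ y=-x_0y_0+x_1y_1+\dots+x_ny_n$, let $\mathbb H^n=\{x : x\circ x=-1,\ x_0>0\}$ be the hyperboloid model of hyperbolic space, with distance $d_H(x,y)=\cosh^{-1}(-x\circ y)$, and let $SO^+(1,n)<GL(\mathbb R^{n+1})$ be its group of orientation-preserving isometries, i.e. the linear maps of determinant $1$ that preserve $\circ$ and $\mathbb H^n$. Definitions. For $S\subset\mathbb H^n$ let $\mathrm{Hull}(S)$ be the closed convex hull of $S$ in $\mathbb R^{n+1}$; it lies in $U_{n+1}=\{x : x\circ x\le -1,\ x_0>0\}$. Let $r_n:U_{n+1}\to\mathbb H^n$, $r_n(x)=x/\sqrt{-x\circ x}$. A face of $\mathrm{Hull}(S)$ is its intersection with a support plane, i.e. with an $n$-dimensional affine plane that meets $\mathrm{Hull}(S)$ and bounds a closed half-space containing it. A face is visible if for each of its points $x$ no point $tx$ with $0\le t<1$ lies in $\mathrm{Hull}(S)$. The Delaunay tessellation of $S$ is the collection of all sets $r_n(F)$, called (Delaunay) cells, where $F$ is a visible face of $\mathrm{Hull}(S)$. A $k$-dimensional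 totally geodesic subspace of $\mathbb H^n$ is a nonempty intersection $W\cap\mathbb H^n$ with a $(k+1)$-dimensional linear subspace $W$ of $\mathbb{R}^{n+1}$; those of dimension $n-1$ bound two closed hyperbolic half-spaces each. The dimension of a nonempty $C\subset\mathbb H^n$ is the least $k$ such that $C$ lies in a $k$-dimensional totally geodesic subspace; an $n$-cell is a cell of dimension $n$. A convex polyhedron in $\mathbb H^n$ is an intersection of a collection of hyperbolic half-spaces whose collection of bounding totally geodesic subspaces is locally finite. A face of a convex set $C\subset\mathbb H^n$ is $C\cap G$, where $G$ is an $(n-1)$-dimensional totally geodesic subspace that meets $C$ and bounds a half-space containing $C$. The closed convex hull in $\mathbb H^n$ of a set is the smallest closed, geodesically convex subset of $\mathbb H^n$ containing it. Theorem. Let $\Gamma<SO^+(1,n)$ be a torsion-free cocompact lattice (a discrete subgroup with $\mathbb H^n/\Gamma$ compact), let $\pi:\mathbb H^n\to\mathbb H^n/\Gamma$ be the projection, and let $S\subset\mathbb H^n$ be nonempty and $\Gamma$-invariant with $\pi(S)$ finite. Then: 1. The Delaunay tessellation of $S$ is a polyhedral decomposition of $\mathbb H^n$: its cells are convex polyhedra,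 their union is $\mathbb H^n$, each face of each cell is a cell, and distinct cells that intersect do so in a face of each. It is locally finite and $\Gamma$-invariant, and $\mathbb H^n$ is the union of its $n$-cells. 2. For every metric sphere $\Sigma=\{x\in\mathbb H^n : d_H(x,c)=r\}$ (with $c\in\mathbb H^n$, $r>0$) that intersects $S$ and whose open ball $\{x\in\mathbb H^n : d_H(x,c)<r\}$ is disjoint from $S$, the closed convex hull in $\mathbb H^n$ of $\Sigma\cap S$ is a Delaunay cell. Conversely, every Delaunay cell has this form. -/

import Mathlib

/-- The Lorentzian inner product `x ∘ y = -x₀y₀ + x₁y₁ + ⋯ + xₙyₙ` on `ℝⁿ⁺¹`. -/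
def lor {n : ℕ} (x y : Fin (n + 1) → ℝ) : ℝ :=
  -(x 0 * y 0) + ∑ i : Fin n, x i.succ * y i.succ

/-- The hyperboloid model `ℍⁿ = {x | x ∘ x = -1, x₀ > 0}`, with the topology induced from `ℝⁿ⁺¹`
(which is the topology of the hyperbolic metric). -/
abbrev Hyp (n : ℕ) : Type := {x : Fin (n + 1) → ℝ // lor x x = -1 ∧ 0 < x 0}

/-- The hyperbolic distance `d_H(x, y) = cosh⁻¹(-(x ∘ y))`. -/
noncomputable def hdist {n : ℕ} (x y : Hyp n) : ℝ := Real.arcosh (-lor x.1 y.1)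

/-- The metric sphere of `ℍⁿ` with center `c` and radius `r`. -/
def hsphere {n : ℕ} (c : Hyp n) (r : ℝ) : Set (Hyp n) := {x | hdist x c = r}

/-- The open metric ball of `ℍⁿ` with center `c` and radius `r`. -/
def hball {n : ℕ} (c : Hyp n) (r : ℝ) : Set (Hyp n) := {x | hdist x c < r}

theorem lor_smul_smul {n : ℕ} (a : ℝ) (x : Fin (n + 1) → ℝ) :
    lor (a • x) (a • x) = a ^ 2 * lor x x := by
  simp only [lor, Pi.smul_apply, smul_eq_mul, mul_add, Finset.mul_sum]
  congr 1
  · ring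
  · exact Finset.sum_congr rfl fun i _ => by ring

/-- A vector with `x ∘ x < 0` has nonzero time coordinate. -/
theorem time_ne_zero {n : ℕ} {x : Fin (n + 1) → ℝ} (h : lor x x < 0) : x 0 ≠ 0 := by
  intro h0
  have h1 : 0 ≤ ∑ i : Fin n, x i.succ * x i.succ :=
    Finset.sum_nonneg fun i _ => mul_self_nonneg _
  simp only [lor, h0] at h
  linarith

/-- `SO⁺(1,n) < GL(ℝⁿ⁺¹)`: the linear maps of determinant one that preserve the Lorentzian inner
product and the sheet `ℍⁿ` of the hyperboloid, i.e. the orientation-preserving isometries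
of `ℍⁿ`. -/
def SOplus (n : ℕ) : Subgroup (GL (Fin (n + 1)) ℝ) where
  carrier := {A | A.1.det = 1 ∧
    (∀ x y : Fin (n + 1) → ℝ, lor (A.1.mulVec x) (A.1.mulVec y) = lor x y) ∧
    ∀ x : Hyp n, 0 < A.1.mulVec x.1 0}
  one_mem' := by
    refine ⟨by simp, by simp, fun x => by simp [x.2.2]⟩
  mul_mem' := by
    rintro A B ⟨hA1, hA2, hA3⟩ ⟨hB1, hB2, hB3⟩
    refine ⟨by simp [hA1, hB1], fun x y => ?_, fun x => ?_⟩
    · simp only [Units.val_mul, ← Matrix.mulVec_mulVec, hA2, hB2]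
    · simp only [Units.val_mul, ← Matrix.mulVec_mulVec]
      exact hA3 ⟨B.1.mulVec x.1, by rw [hB2]; exact x.2.1, hB3 x⟩
  inv_mem' := by
    rintro A ⟨hA1, hA2, hA3⟩
    have key : ∀ x, A.1.mulVec ((A⁻¹).1.mulVec x) = x := fun x => by
      rw [Matrix.mulVec_mulVec, ← Units.val_mul]; simp
    have hinv : ∀ x y : Fin (n + 1) → ℝ,
        lor ((A⁻¹).1.mulVec x) ((A⁻¹).1.mulVec y) = lor x y := fun x y => by
      rw [← hA2, key, key]
    refine ⟨?_, hinv, fun x => ?_⟩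
    · have h := congrArg Matrix.det (show A.1 * (A⁻¹).1 = 1 by rw [← Units.val_mul]; simp)
      simpa [Matrix.det_mul, hA1] using h
    · have hq : lor ((A⁻¹).1.mulVec x.1) ((A⁻¹).1.mulVec x.1) = -1 := by rw [hinv]; exact x.2.1
      by_contra hneg
      have hne : ((A⁻¹).1.mulVec x.1) 0 ≠ 0 := time_ne_zero (by rw [hq]; norm_num)
      have hlt : ((A⁻¹).1.mulVec x.1) 0 < 0 := lt_of_le_of_ne (not_lt.mp hneg) hne
      have hy := hA3 ⟨(-1 : ℝ) • ((A⁻¹).1.mulVec x.1), by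
        rw [lor_smul_smul, hq]; norm_num, by simpa using hlt⟩
      rw [Matrix.mulVec_smul, key] at hy
      have := x.2.2
      simp at hy
      linarith

/-- The linear action of `SO⁺(1,n)` on `ℍⁿ`. -/
instance SOplus.instMulActionHyp (n : ℕ) : MulAction (SOplus n) (Hyp n) where
  smul A x := ⟨A.1.1.mulVec x.1, by rw [A.2.2.1]; exact x.2.1, A.2.2.2 x⟩
  one_smul x := Subtype.ext (by
    change ((1 : GL (Fin (n + 1)) ℝ).1).mulVec x.1 = x.1
    simp)
  mul_smul A B x := Subtype.ext (by
    change ((A.1 * B.1 : GL (Fin (n + 1)) ℝ).1).mulVec x.1 = A.1.1.mulVec (B.1.1.mulVec x.1)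
    rw [Units.val_mul, Matrix.mulVec_mulVec])

/-- `Γ < SO⁺(1,n)` is a cocompact lattice: it is discrete and `ℍⁿ/Γ` is compact (so that `Γ` has a
fundamental domain with compact closure, in particular one of finite volume). -/
def IsCocompactLattice {n : ℕ} (Γ : Subgroup (SOplus n)) : Prop :=
  DiscreteTopology Γ ∧ CompactSpace (MulAction.orbitRel.Quotient Γ (Hyp n))

/-- `Γ` is torsion-free: only the identity has finite order. -/
def IsTorsionFreeGroup {n : ℕ} (Γ : Subgroup (SOplus n)) : Prop :=
  ∀ γ ∈ Γ, IsOfFinOrder γ → γ = 1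

/-- The covering projection `π : ℍⁿ → ℍⁿ/Γ`. -/
def quotProj {n : ℕ} (Γ : Subgroup (SOplus n)) (x : Hyp n) :
    MulAction.orbitRel.Quotient Γ (Hyp n) :=
  Quotient.mk (MulAction.orbitRel Γ (Hyp n)) x

/-! ### Convexity in `ℝⁿ⁺¹` and the Delaunay tessellation -/

/-- `Hull(S)`, the closed convex hull of `S ⊆ ℍⁿ` in `ℝⁿ⁺¹`. -/
def eHull {n : ℕ} (S : Set (Hyp n)) : Set (Fin (n + 1) → ℝ) :=
  closedConvexHull ℝ ((fun x : Hyp n => x.1) '' S)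

/-- The affine hyperplane `{x | f x = c}`, `f ≠ 0`, is a support plane for `C`: it meets `C`, and
`C` lies in one of the half-spaces that it bounds. (Replacing `(f, c)` by `(-f, -c)` exchanges
the two half-spaces.) -/
def IsSupportPlane {n : ℕ} (C : Set (Fin (n + 1) → ℝ))
    (f : (Fin (n + 1) → ℝ) →ₗ[ℝ] ℝ) (c : ℝ) : Prop :=
  f ≠ 0 ∧ (∀ x ∈ C, c ≤ f x) ∧ ∃ x ∈ C, f x = c

/-- A face of the closed convex set `C` is its intersection with a support plane. -/
def IsFace {n : ℕ} (C F : Set (Fin (n + 1) → ℝ)) : Prop :=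
  ∃ (f : (Fin (n + 1) → ℝ) →ₗ[ℝ] ℝ) (c : ℝ), IsSupportPlane C f c ∧ F = C ∩ {x | f x = c}

/-- `x ∈ C` is visible if it is the first point of `C` on the ray from the origin through `x`. -/
def IsVisiblePoint {n : ℕ} (C : Set (Fin (n + 1) → ℝ)) (x : Fin (n + 1) → ℝ) : Prop :=
  x ∈ C ∧ ∀ t : ℝ, 0 ≤ t → t < 1 → t • x ∉ C

/-- A face is visible if all of its points are. -/
def IsVisibleFace {n : ℕ} (C F : Set (Fin (n + 1) → ℝ)) : Prop :=
  IsFace C F ∧ ∀ x ∈ F, IsVisiblePoint C x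

/-- `U_{n+1} = {x | x ∘ x ≤ -1, x₀ > 0}`, the convex region bounded by `ℍⁿ`. -/
def upperRegion (n : ℕ) : Set (Fin (n + 1) → ℝ) := {x | lor x x ≤ -1 ∧ 0 < x 0}

/-- The radial projection `r_n : U_{n+1} → ℍⁿ`, `x ↦ x / √(-(x ∘ x))`. -/
noncomputable def radial {n : ℕ} (x : upperRegion n) : Hyp n :=
  ⟨(Real.sqrt (-lor x.1 x.1))⁻¹ • x.1, by
    have h : 0 < -lor x.1 x.1 := by have := x.2.1; linarith
    have hs := Real.sqrt_pos.mpr h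
    refine ⟨?_, ?_⟩
    · rw [lor_smul_smul, inv_pow, Real.sq_sqrt h.le]
      have : lor x.1 x.1 ≠ 0 := by linarith
      field_simp
    · simpa using mul_pos (inv_pos.mpr hs) x.2.2⟩

/-- The Delaunay tessellation of `S ⊆ ℍⁿ`: the collection of the radial projections `r_n(F)` of the
visible faces `F` of `Hull(S)`. (Note `Hull(S) ⊆ U_{n+1}`.) -/
def Delaunay {n : ℕ} (S : Set (Hyp n)) : Set (Set (Hyp n)) :=
  {D | ∃ F, IsVisibleFace (eHull S) F ∧ D = radial '' ((fun x : upperRegion n => x.1) ⁻¹' F)}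

/-! ### Convexity and polyhedra in `ℍⁿ` -/

/-- The geodesic arc joining `x` to `y`: the points of `ℍⁿ` that are non-negative linear
combinations of `x` and `y`. -/
def geodArc {n : ℕ} (x y : Hyp n) : Set (Hyp n) :=
  {z | ∃ a b : ℝ, 0 ≤ a ∧ 0 ≤ b ∧ z.1 = a • x.1 + b • y.1}

/-- A subset of `ℍⁿ` is convex if it contains the geodesic arc between any two of its points. -/
def HConvex {n : ℕ} (C : Set (Hyp n)) : Prop := ∀ x ∈ C, ∀ y ∈ C, geodArc x y ⊆ C

/-- The closed convex hull in `ℍⁿ`: the smallest closed convex subset containing `A`. -/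
def hHull {n : ℕ} (A : Set (Hyp n)) : Set (Hyp n) :=
  ⋂₀ {C | IsClosed C ∧ HConvex C ∧ A ⊆ C}

/-- `B` is a hyperbolic half-space with bounding totally geodesic subspace `G = V ∩ ℍⁿ`, where
`V = ker f` is an `n`-dimensional time-like subspace of `ℝⁿ⁺¹` (one that meets `ℍⁿ`). -/
def IsHHalfSpace {n : ℕ} (B G : Set (Hyp n)) : Prop :=
  ∃ f : (Fin (n + 1) → ℝ) →ₗ[ℝ] ℝ, f ≠ 0 ∧ G.Nonempty ∧
    B = {x | 0 ≤ f x.1} ∧ G = {x | f x.1 = 0}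

/-- A collection of subsets of `ℍⁿ` is locally finite. -/
def LocFinColl {n : ℕ} (𝒞 : Set (Set (Hyp n))) : Prop :=
  LocallyFinite (fun C : 𝒞 => (C : Set (Hyp n)))

/-- A convex polyhedron in `ℍⁿ`: the intersection of a collection of hyperbolic half-spaces whose
associated collection of bounding totally geodesic subspaces is locally finite. -/
def IsHPolyhedron {n : ℕ} (C : Set (Hyp n)) : Prop :=
  ∃ 𝒬 : Set (Set (Hyp n) × Set (Hyp n)), (∀ p ∈ 𝒬, IsHHalfSpace p.1 p.2) ∧
    LocFinColl (Prod.snd '' 𝒬) ∧ C = ⋂ p ∈ 𝒬, p.1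

/-- A face of a convex set `C` of `ℍⁿ`: its intersection with a support plane, i.e. with an
`(n-1)`-dimensional totally geodesic subspace that meets `C` and bounds a half-space
containing `C`. -/
def IsHFace {n : ℕ} (C D : Set (Hyp n)) : Prop :=
  ∃ B G, IsHHalfSpace B G ∧ C ⊆ B ∧ (C ∩ G).Nonempty ∧ D = C ∩ G

/-- The dimension in `ℍⁿ` of a nonempty set: the least `k` such that `C` lies in a `k`-dimensional
totally geodesic subspace, i.e. in `W ∩ ℍⁿ` for a time-like subspace `W` of dimension `k + 1`. -/
noncomputable def hDim {n : ℕ} (C : Set (Hyp n)) : ℕ :=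
  sInf {k | ∃ W : Submodule ℝ (Fin (n + 1) → ℝ), Module.finrank ℝ W = k + 1 ∧
    (∃ x : Hyp n, x.1 ∈ W) ∧ ∀ x ∈ C, x.1 ∈ W}

/-- A polyhedral decomposition of `ℍⁿ`: a collection of convex polyhedra with union `ℍⁿ` that
contains each face of each of its members, such that distinct members that intersect do so in a
face of each. -/
def IsPolyhedralDecomposition {n : ℕ} (𝒟 : Set (Set (Hyp n))) : Prop :=
  (∀ C ∈ 𝒟, IsHPolyhedron C) ∧ ⋃₀ 𝒟 = Set.univ ∧
    (∀ C ∈ 𝒟, ∀ D, IsHFace C D → D ∈ 𝒟) ∧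
    ∀ C ∈ 𝒟, ∀ C' ∈ 𝒟, C ≠ C' → (C ∩ C').Nonempty →
      IsHFace C (C ∩ C') ∧ IsHFace C' (C ∩ C')

/-! Write `lorQ x y` for `-(x ∘ y)`, which is positive on the future cone. A support plane of the
hull that misses the origin can be normalised to `lorQ v x = 1`, with `1 ≤ lorQ v s` for all `s ∈
S`. The proof replaces faces by these supporting vectors: the cells turn out to be the sets
`coneCell (contacts S v)`, the hyperbolic parts of the cones over the contact points
(`mem_Delaunay_iff`).

Only two properties of `S` matter: it is a net, and it has finitely many points in bounded regions
(`IsDelone`). The first comes from compactness of the quotient, the second from discreteness of the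
group and finiteness of the number of orbits. Because `S` is a net, every supporting vector is
future time-like, so `v = c / cosh r` as soon as `lorQ v v ≤ 1`. Then `v` is supporting exactly when
the open ball of radius `r` about `c` misses `S`, and its contacts are the points of `S` on the
sphere. This is the correspondence with empty spheres.

The combinatorics is linear programming: `x` lies in the cone over the contacts of `v` if and only
if `v` minimises `lorQ · x` among supporting vectors. One direction is immediate
(`lorQ_le_of_mem_lcone_contacts`). The other (`IsDelone.mem_lcone_contacts`) separates `x` from a
finitely generated cone and moves `v` slightly (`IsDelone.exists_perturbation`). Two cells thus meet
where their two functionals agree, which is a face of each. Perturbing `v` along the functional that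
cuts out a face exhibits this face as a cell. A minimiser exists by compactness, and an extreme one
has spanning contacts, so the `n`-cells cover. Local finiteness holds because empty balls in the
complement of a net have bounded radius. -/

/-! ### The Minkowski–Weyl theorem for finitely generated cones -/

/-- A finitely generated cone is the intersection of finitely many linear half-spaces. -/
theorem exists_finite_halfSpaces_hull {E : Type*} [AddCommGroup E] [Module ℝ E]
    [FiniteDimensional ℝ E] {T : Set E} (hT : T.Finite) :
    ∃ G : Set (E →ₗ[ℝ] ℝ), G.Finite ∧
      ∀ x, x ∈ PointedCone.hull ℝ T ↔ ∀ g ∈ G, 0 ≤ g x := by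
  induction T, hT using Set.Finite.induction_on with
  | empty =>
    let b := Module.finBasis ℝ E
    refine ⟨Set.range (fun i => b.coord i) ∪ Set.range (fun i => -b.coord i),
      (Set.finite_range _).union (Set.finite_range _), fun x => ?_⟩
    simp only [PointedCone.hull, Submodule.span_empty, Submodule.mem_bot]
    constructor
    · rintro rfl g -
      simp
    · intro h
      refine b.ext_elem fun i => ?_
      have h1 := h _ (Or.inl ⟨i, rfl⟩)
      have h2 := h _ (Or.inr ⟨i, rfl⟩)
      simp at h1 h2 ⊢
      linarith
  | @insert t T _ _ ih =>
    obtain ⟨G, hG, hGT⟩ := ih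
    -- Fourier–Motzkin elimination of the coefficient of `t`: each pair of functionals of opposite
    -- sign at `t` combines to one that vanishes at `t`.
    refine ⟨{g ∈ G | 0 ≤ g t} ∪ (fun p : (E →ₗ[ℝ] ℝ) × (E →ₗ[ℝ] ℝ) =>
      p.1 t • p.2 - p.2 t • p.1) '' ({g ∈ G | 0 < g t} ×ˢ {g ∈ G | g t < 0}), ?_, fun x => ?_⟩
    · exact (hG.subset (Set.sep_subset _ _)).union
        (((hG.subset (Set.sep_subset _ _)).prod (hG.subset (Set.sep_subset _ _))).image _)
    rw [PointedCone.hull, Submodule.mem_span_insert]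
    constructor
    · rintro ⟨⟨a, ha⟩, z, hz, rfl⟩ g hg
      have hz' := (hGT z).1 hz
      rcases hg with ⟨hg, hgt⟩ | ⟨⟨g, h⟩, ⟨⟨hg, hgt⟩, ⟨hh, hht⟩⟩, rfl⟩
      · have := hz' g hg
        simp only [Nonneg.mk_smul, map_add, map_smul, smul_eq_mul]
        positivity
      · have h1 := hz' g hg
        have h2 := hz' h hh
        simp only [Nonneg.mk_smul, map_add, map_smul, smul_eq_mul, LinearMap.sub_apply,
          LinearMap.smul_apply]
        have e1 := mul_nonneg hgt.le h2
        have e2 := mul_nonneg (neg_nonneg.2 hht.le) h1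
        nlinarith
    · intro hx
      -- The conditions `0 ≤ g (x - a • t)` bound `a` below when `g t < 0` and above when `g t > 0`.
      -- The largest lower bound, or `0`, is taken; the combined functionals say that it respects
      -- every upper bound.
      obtain ⟨a, ha0, haL, haU⟩ : ∃ a : ℝ, 0 ≤ a ∧ (∀ h ∈ G, h t < 0 → h x / h t ≤ a) ∧
          (a = 0 ∨ ∃ h ∈ G, h t < 0 ∧ a = h x / h t) := by
        have hfin : (insert 0 ((fun h : E →ₗ[ℝ] ℝ => h x / h t) '' {g ∈ G | g t < 0})).Finite :=
          ((hG.subset (Set.sep_subset _ _)).image _).insert _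
        obtain ⟨a, ha, hmax⟩ := hfin.exists_maximal ⟨0, Set.mem_insert _ _⟩
        have hmax' : ∀ b ∈ (insert 0 ((fun h : E →ₗ[ℝ] ℝ => h x / h t) '' {g ∈ G | g t < 0})),
            b ≤ a := fun b hb => by
          rcases le_total b a with h | h
          · exact h
          · exact hmax hb h
        refine ⟨a, hmax' 0 (Set.mem_insert _ _),
          fun h hh hht => hmax' _ (Or.inr ⟨h, ⟨hh, hht⟩, rfl⟩), ?_⟩
        rcases ha with ha | ⟨h, ⟨hh, hht⟩, rfl⟩
        · exact Or.inl ha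
        · exact Or.inr ⟨h, hh, hht, rfl⟩
      refine ⟨⟨a, ha0⟩, x - a • t, (hGT _).2 fun g hg => ?_, by simp [Nonneg.mk_smul]⟩
      simp only [map_sub, map_smul, smul_eq_mul]
      rcases lt_trichotomy (g t) 0 with h | h | h
      · have := haL g hg h
        rw [div_le_iff_of_neg h] at this
        linarith
      · have := hx g (Or.inl ⟨hg, h.ge⟩)
        rw [h]
        linarith
      · rcases haU with rfl | ⟨k, hk, hkt, rfl⟩
        · have := hx g (Or.inl ⟨hg, h.le⟩)
          linarith
        · have := hx _ (Or.inr ⟨⟨g, k⟩, ⟨⟨hg, h⟩, ⟨hk, hkt⟩⟩, rfl⟩)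
          simp only [LinearMap.sub_apply, LinearMap.smul_apply, smul_eq_mul] at this
          rw [sub_nonneg, div_mul_eq_mul_div, div_le_iff_of_neg hkt]
          linarith

/-! ### The Lorentzian form -/

/-- The bilinear form `(x, y) ↦ -(x ∘ y)`. -/
noncomputable def lorQ {n : ℕ} : (Fin (n + 1) → ℝ) →ₗ[ℝ] (Fin (n + 1) → ℝ) →ₗ[ℝ] ℝ :=
  LinearMap.mk₂ ℝ (fun x y => -lor x y)
    (fun x y z => by
      simp only [lor, Pi.add_apply, add_mul, Finset.sum_add_distrib]; ring)
    (fun c x y => by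
      simp only [lor, Pi.smul_apply, smul_eq_mul, mul_assoc, ← Finset.mul_sum]; ring)
    (fun x y z => by
      simp only [lor, Pi.add_apply, mul_add, Finset.sum_add_distrib]; ring)
    (fun c x y => by
      simp only [lor, Pi.smul_apply, smul_eq_mul, mul_left_comm _ c, ← Finset.mul_sum]; ring)

theorem lorQ_eq_neg_lor {n : ℕ} (x y : Fin (n + 1) → ℝ) : lorQ x y = -lor x y := rfl

theorem lorQ_apply {n : ℕ} (x y : Fin (n + 1) → ℝ) :
    lorQ x y = x 0 * y 0 - ∑ i : Fin n, x i.succ * y i.succ := by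
  rw [lorQ_eq_neg_lor, lor]; ring

theorem lorQ_comm {n : ℕ} (x y : Fin (n + 1) → ℝ) : lorQ x y = lorQ y x := by
  simp only [lorQ_apply, mul_comm]

theorem Hyp.lorQ_self {n : ℕ} (x : Hyp n) : lorQ x.1 x.1 = 1 := by
  rw [lorQ_eq_neg_lor, x.2.1, neg_neg]

/-- A vector is future causal if it lies in the closed future light cone. -/
def FutureCausal {n : ℕ} (x : Fin (n + 1) → ℝ) : Prop := 0 ≤ lorQ x x ∧ 0 ≤ x 0

theorem Hyp.futureCausal {n : ℕ} (x : Hyp n) : FutureCausal x.1 :=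
  ⟨by rw [x.lorQ_self]; norm_num, x.2.2.le⟩

theorem FutureCausal.abs_apply_le {n : ℕ} {x : Fin (n + 1) → ℝ} (h : FutureCausal x)
    (i : Fin (n + 1)) : |x i| ≤ x 0 := by
  refine Fin.cases ?_ (fun j => ?_) i
  · rw [abs_of_nonneg h.2]
  · refine abs_le_of_sq_le_sq ?_ h.2
    have h1 := h.1
    rw [lorQ_apply] at h1
    have h2 := Finset.single_le_sum (f := fun i : Fin n => x i.succ * x i.succ)
      (fun i _ => mul_self_nonneg _) (Finset.mem_univ j)
    rw [pow_two, pow_two]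
    linarith

theorem FutureCausal.eq_zero {n : ℕ} {x : Fin (n + 1) → ℝ} (h : FutureCausal x)
    (h0 : x 0 ≤ 0) : x = 0 := by
  funext i
  have := h.abs_apply_le i
  exact abs_eq_zero.1 (le_antisymm (this.trans h0) (abs_nonneg _))

/-- Cauchy–Schwarz for the spatial parts, whose norms are at most the time coordinates, strictly so
for `x`. -/
theorem lorQ_pos {n : ℕ} {x y : Fin (n + 1) → ℝ} (hx : 0 < lorQ x x) (hx0 : 0 ≤ x 0)
    (hy : FutureCausal y) (hne : y ≠ 0) : 0 < lorQ x y := by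
  have hy0 : 0 < y 0 := by
    by_contra h
    exact hne (hy.eq_zero (not_lt.1 h))
  have hy1 := hy.1
  have hcs := Finset.sum_mul_sq_le_sq_mul_sq Finset.univ (fun i : Fin n => x i.succ)
    (fun i : Fin n => y i.succ)
  have hA : 0 ≤ ∑ i : Fin n, x i.succ ^ 2 := Finset.sum_nonneg fun i _ => sq_nonneg _
  rw [lorQ_apply] at hx hy1 ⊢
  simp only [← pow_two] at hx hy1
  have h1 : (∑ i : Fin n, x i.succ * y i.succ) ^ 2 < (x 0 * y 0) ^ 2 := by
    refine hcs.trans_lt ?_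
    rw [mul_pow]
    calc _ ≤ (∑ i : Fin n, x i.succ ^ 2) * y 0 ^ 2 := by gcongr; linarith
      _ < _ := by gcongr; linarith
  have h2 := abs_lt_of_sq_lt_sq h1 (by positivity)
  linarith [(abs_lt.1 h2).2]

theorem lorQ_nonneg {n : ℕ} {x y : Fin (n + 1) → ℝ} (hx : FutureCausal x)
    (hy : FutureCausal y) : 0 ≤ lorQ x y := by
  have hx1 := hx.1
  have hy1 := hy.1
  have hcs := Finset.sum_mul_sq_le_sq_mul_sq Finset.univ (fun i : Fin n => x i.succ)
    (fun i : Fin n => y i.succ)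
  rw [lorQ_apply] at hx1 hy1 ⊢
  simp only [← pow_two] at hx1 hy1
  have h1 : (∑ i : Fin n, x i.succ * y i.succ) ^ 2 ≤ (x 0 * y 0) ^ 2 := by
    refine hcs.trans ?_
    rw [mul_pow]
    have hA : 0 ≤ ∑ i : Fin n, y i.succ ^ 2 := Finset.sum_nonneg fun i _ => sq_nonneg _
    gcongr <;> linarith
  have h2 := abs_le_of_sq_le_sq h1 (mul_nonneg hx.2 hy.2)
  linarith [(abs_le.1 h2).2]

theorem lorQ_sub_self {n : ℕ} (x y : Fin (n + 1) → ℝ) :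
    lorQ (x - y) (x - y) = lorQ x x - 2 * lorQ x y + lorQ y y := by
  simp only [map_sub, LinearMap.sub_apply, lorQ_comm y x]; ring

theorem lorQ_add_self {n : ℕ} (x y : Fin (n + 1) → ℝ) :
    lorQ (x + y) (x + y) = lorQ x x + 2 * lorQ x y + lorQ y y := by
  simp only [map_add, LinearMap.add_apply, lorQ_comm y x]; ring

theorem lorQ_smul_smul {n : ℕ} (a b : ℝ) (x y : Fin (n + 1) → ℝ) :
    lorQ (a • x) (b • y) = a * b * lorQ x y := by
  simp only [map_smul, LinearMap.smul_apply, smul_eq_mul]; ring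

theorem futureCausal_of_lorQ_pos {n : ℕ} {w : Fin (n + 1) → ℝ} (hw : 0 ≤ lorQ w w)
    {y : Hyp n} (hy : 0 < lorQ w y.1) : FutureCausal w := by
  refine ⟨hw, ?_⟩
  by_contra h
  have h1 : FutureCausal (-w) := ⟨by simpa using hw, by simp; linarith⟩
  have := lorQ_nonneg h1 y.futureCausal
  simp at this
  linarith

theorem FutureCausal.time_pos {n : ℕ} {w : Fin (n + 1) → ℝ} (hw : FutureCausal w)
    (hne : w ≠ 0) : 0 < w 0 := by
  by_contra h
  exact hne (hw.eq_zero (not_lt.1 h))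

theorem Hyp.ne_zero {n : ℕ} (x : Hyp n) : x.1 ≠ 0 := by
  intro h
  have := x.2.2
  rw [h] at this
  simp at this

theorem Hyp.lorQ_pos {n : ℕ} (x : Hyp n) {y : Fin (n + 1) → ℝ} (hy : FutureCausal y)
    (hne : y ≠ 0) : 0 < lorQ x.1 y :=
  _root_.lorQ_pos (by rw [x.lorQ_self]; norm_num) x.2.2.le hy hne

/-- Otherwise the component of `x` orthogonal to `y` would be time-like, while a time-like vector is
never orthogonal to a nonzero causal one. -/
theorem Hyp.one_le_lorQ {n : ℕ} (x y : Hyp n) : 1 ≤ lorQ x.1 y.1 := by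
  by_contra! h
  have hpos := x.lorQ_pos y.futureCausal y.ne_zero
  have h1 : 0 < lorQ (x.1 - lorQ x.1 y.1 • y.1) (x.1 - lorQ x.1 y.1 • y.1) := by
    rw [lorQ_sub_self, lorQ_smul_smul, x.lorQ_self, y.lorQ_self, map_smul, smul_eq_mul]
    nlinarith
  have h2 : lorQ (x.1 - lorQ x.1 y.1 • y.1) y.1 = 0 := by
    simp [y.lorQ_self]
  rcases le_total 0 ((x.1 - lorQ x.1 y.1 • y.1) 0) with h0 | h0
  · exact (_root_.lorQ_pos h1 h0 y.futureCausal y.ne_zero).ne' h2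
  · have := _root_.lorQ_pos (x := -(x.1 - lorQ x.1 y.1 • y.1))
      (by rwa [map_neg, map_neg, LinearMap.neg_apply, neg_neg])
      (by simpa using h0) y.futureCausal y.ne_zero
    rw [map_neg, LinearMap.neg_apply, h2] at this
    simp at this

/-- The orthogonal complement of a point of `ℍⁿ` is positive definite for `∘`. -/
theorem Hyp.eq_zero_of_orthogonal {n : ℕ} (c : Hyp n) {u : Fin (n + 1) → ℝ}
    (h : lorQ c.1 u = 0) (hu : 0 ≤ lorQ u u) : u = 0 := by
  by_contra hne
  rcases le_total 0 (u 0) with h0 | h0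
  · exact (c.lorQ_pos ⟨hu, h0⟩ hne).ne' h
  · have := c.lorQ_pos (y := -u) ⟨by simpa using hu, by simpa using h0⟩ (neg_ne_zero.2 hne)
    rw [map_neg, h] at this
    simp at this

theorem Hyp.eq_of_lorQ_eq_one {n : ℕ} {x y : Hyp n} (h : lorQ x.1 y.1 = 1) : x = y := by
  have h1 : x.1 - y.1 = 0 := x.eq_zero_of_orthogonal (by rw [map_sub, x.lorQ_self, h]; ring)
    (by rw [lorQ_sub_self, x.lorQ_self, y.lorQ_self, h]; norm_num)
  exact Subtype.ext (sub_eq_zero.1 h1)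

/-- This is the source of a Harnack-type inequality: pairing with a future causal `z` compares the
values of `z` at `x` and at `y`. -/
theorem Hyp.futureCausal_smul_sub {n : ℕ} {x y : Hyp n} {C : ℝ} (h : lorQ x.1 y.1 ≤ C) :
    FutureCausal ((2 * C) • y.1 - x.1) := by
  have h1 := x.one_le_lorQ y
  refine futureCausal_of_lorQ_pos (y := y) ?_ ?_
  · rw [lorQ_sub_self, lorQ_smul_smul, x.lorQ_self, y.lorQ_self, map_smul, LinearMap.smul_apply,
      lorQ_comm, smul_eq_mul]
    nlinarith
  · simp only [map_sub, map_smul, LinearMap.sub_apply, LinearMap.smul_apply, y.lorQ_self,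
      smul_eq_mul]
    linarith

/-- Comparison of a future causal functional at two points of `ℍⁿ` at bounded distance. -/
theorem FutureCausal.lorQ_le {n : ℕ} {z : Fin (n + 1) → ℝ} (hz : FutureCausal z)
    {x y : Hyp n} {C : ℝ} (h : lorQ x.1 y.1 ≤ C) : lorQ z x.1 ≤ 2 * C * lorQ z y.1 := by
  have := lorQ_nonneg hz (Hyp.futureCausal_smul_sub h)
  simp only [map_sub, map_smul, smul_eq_mul] at this
  linarith

/-- The base point of the hyperboloid. -/
noncomputable def Hyp.base (n : ℕ) : Hyp n :=
  ⟨Pi.single 0 1, by simp [lor], by simp⟩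

theorem lorQ_base {n : ℕ} (v : Fin (n + 1) → ℝ) : lorQ v (Hyp.base n).1 = v 0 := by
  simp [lorQ_apply, Hyp.base]

/-- A future time-like vector is a positive multiple of a point of `ℍⁿ`. -/
theorem exists_eq_smul_hyp {n : ℕ} {w : Fin (n + 1) → ℝ} (hw : 0 < lorQ w w) (hw0 : 0 < w 0) :
    ∃ x : Hyp n, w = √(lorQ w w) • x.1 := by
  have hs := Real.sqrt_pos.2 hw
  refine ⟨⟨(√(lorQ w w))⁻¹ • w, ?_, ?_⟩, ?_⟩
  · have h1 : lorQ ((√(lorQ w w))⁻¹ • w) ((√(lorQ w w))⁻¹ • w) = 1 := by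
      rw [lorQ_smul_smul, ← mul_inv, Real.mul_self_sqrt hw.le, inv_mul_cancel₀ hw.ne']
    rw [lorQ_eq_neg_lor] at h1
    linarith
  · simpa using mul_pos (inv_pos.2 hs) hw0
  · rw [smul_smul, mul_inv_cancel₀ hs.ne', one_smul]

/-- The closed future cone is self-dual. If `v` were space-like, keeping its spatial part and
choosing a time coordinate slightly above the spatial norm would give a time-like vector that pairs
negatively with `v`. -/
theorem futureCausal_of_forall_nonneg {n : ℕ} {v : Fin (n + 1) → ℝ}
    (h : ∀ p : Hyp n, 0 ≤ lorQ v p.1) : FutureCausal v := by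
  have hv0 : 0 ≤ v 0 := by simpa [lorQ_base] using h (Hyp.base n)
  refine ⟨?_, hv0⟩
  by_contra! hneg
  set B := ∑ i : Fin n, v i.succ * v i.succ with hB
  have hlt : v 0 * v 0 < B := by rw [lorQ_apply] at hneg; linarith
  have hBpos : 0 < B := (mul_self_nonneg _).trans_lt hlt
  have hsq : √B * √B = B := Real.mul_self_sqrt hBpos.le
  have hvs : v 0 < √B := by
    rw [Real.lt_sqrt hv0, pow_two]; exact hlt
  obtain ⟨a, ha1, ha2⟩ : ∃ a, √B < a ∧ v 0 * a < B := by
    rcases hv0.eq_or_lt with h0 | h0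
    · exact ⟨√B + 1, by linarith, by rw [← h0]; simpa using hBpos⟩
    · obtain ⟨a, h1, h2⟩ := exists_between (show √B < B / v 0 by
        rw [lt_div_iff₀ h0]; nlinarith [Real.sqrt_nonneg B])
      exact ⟨a, h1, by rw [lt_div_iff₀ h0] at h2; linarith⟩
  have ha0 : 0 < a := (Real.sqrt_nonneg B).trans_lt ha1
  let w : Fin (n + 1) → ℝ := Fin.cons a (fun i => v i.succ)
  have hww : lorQ w w = a * a - B := by simp [lorQ_apply, w, hB]
  obtain ⟨x, hx⟩ := exists_eq_smul_hyp (w := w)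
    (by rw [hww]; nlinarith [Real.sqrt_nonneg B]) (by simpa [w] using ha0)
  have h1 := mul_nonneg (Real.sqrt_nonneg (lorQ w w)) (h x)
  rw [← smul_eq_mul, ← map_smul, ← hx] at h1
  have h2 : lorQ v w = v 0 * a - B := by simp [lorQ_apply, w, hB]
  linarith

theorem Hyp.exists_spacelike_orthogonal {n : ℕ} (hn : 1 ≤ n) (p : Hyp n) :
    ∃ u : Fin (n + 1) → ℝ, lorQ u u < 0 ∧ lorQ p.1 u = 0 := by
  let e : Fin (n + 1) → ℝ := Pi.single (Fin.succ ⟨0, hn⟩) 1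
  have he : lorQ e e = -1 := by
    rw [lorQ_apply]
    have : ∀ i : Fin n, e i.succ * e i.succ = if i = ⟨0, hn⟩ then 1 else 0 := by
      intro i
      by_cases hi : i = ⟨0, hn⟩
      · subst hi; simp [e]
      · rw [if_neg hi]
        have : i.succ ≠ Fin.succ ⟨0, hn⟩ := fun h => hi (Fin.succ_injective _ h)
        simp only [e, Pi.single_apply, if_neg this, mul_zero]
    simp only [this]
    simp [e]
  refine ⟨e - lorQ p.1 e • p.1, ?_, ?_⟩
  · rw [lorQ_sub_self, lorQ_smul_smul, map_smul, he, p.lorQ_self, lorQ_comm e, smul_eq_mul]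
    nlinarith [sq_nonneg (lorQ p.1 e)]
  · rw [map_sub, map_smul, p.lorQ_self]; simp

/-- A linear functional that is negative somewhere on `ℍⁿ` is unbounded below there. -/
theorem exists_lorQ_le {n : ℕ} (hn : 1 ≤ n) {v : Fin (n + 1) → ℝ} {p : Hyp n}
    (h : lorQ v p.1 < 0) (M : ℝ) : ∃ x : Hyp n, lorQ v x.1 ≤ M := by
  obtain ⟨u, hu, hup⟩ := p.exists_spacelike_orthogonal hn
  wlog hvu : lorQ v u ≤ 0 generalizing u
  · exact this (-u) (by simpa using hu) (by simpa using hup) (by simp; linarith)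
  obtain ⟨t, ht1, ht⟩ : ∃ t : ℝ, 1 ≤ t ∧ t * lorQ v p.1 ≤ M := by
    refine ⟨max 1 (M / lorQ v p.1), le_max_left _ _, ?_⟩
    have := le_max_right 1 (M / lorQ v p.1)
    rwa [div_le_iff_of_neg h] at this
  -- The point `t • p + k • u` lies on the hyperboloid for this `k`; the sign of `u` ensures that
  -- the term `k • u` does not increase the value of `v`.
  set k := √((t ^ 2 - 1) / (-lorQ u u)) with hk
  have hk2 : k * k * (-lorQ u u) = t ^ 2 - 1 := by
    rw [hk, Real.mul_self_sqrt (div_nonneg (by nlinarith) (by linarith)),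
      div_mul_cancel₀ _ (by linarith)]
  have hq : lorQ (t • p.1 + k • u) (t • p.1 + k • u) = 1 := by
    rw [lorQ_add_self, lorQ_smul_smul, lorQ_smul_smul, lorQ_smul_smul, hup, p.lorQ_self]
    linarith
  have hfc : FutureCausal (t • p.1 + k • u) := by
    refine futureCausal_of_lorQ_pos (y := p) (by rw [hq]; norm_num) ?_
    rw [lorQ_comm, map_add, map_smul, map_smul, hup, p.lorQ_self]
    simp; linarith
  refine ⟨⟨t • p.1 + k • u, ?_, hfc.time_pos ?_⟩, ?_⟩
  · rw [lorQ_eq_neg_lor] at hq; linarith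
  · intro h0
    rw [h0] at hq
    simp at hq
  · have : 0 ≤ k := Real.sqrt_nonneg _
    simp only [map_add, map_smul, smul_eq_mul]
    nlinarith

/-! ### Linear functionals bounded below on a net -/

/-- The set `S` meets every ball of some fixed radius. -/
def IsNet {n : ℕ} (S : Set (Hyp n)) : Prop := ∃ C : ℝ, ∀ x : Hyp n, ∃ s ∈ S, lorQ x.1 s.1 ≤ C

/-- A functional negative somewhere is arbitrarily negative at some `x`. Then `x - v` is future
causal, and comparing its values at `x` and at a nearby point `s` of the net shows that `v` is still
too negative at `s`. -/
theorem IsNet.lorQ_nonneg {n : ℕ} (hn : 1 ≤ n) {S : Set (Hyp n)} (hS : IsNet S)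
    {v : Fin (n + 1) → ℝ} {c : ℝ} (hv : ∀ s ∈ S, c ≤ lorQ v s.1) (p : Hyp n) :
    0 ≤ lorQ v p.1 := by
  by_contra! hp
  obtain ⟨C, hC⟩ := hS
  obtain ⟨x, hx⟩ := exists_lorQ_le hn hp
    (min 0 (min (lorQ v v) (2 * C * c - 2 * C * C)) - 1)
  have hx0 : lorQ v x.1 ≤ -1 := hx.trans (by linarith [min_le_left (0 : ℝ) (min (lorQ v v) (2 * C * c - 2 * C * C))])
  have hx1 : lorQ v x.1 ≤ lorQ v v := hx.trans (by
    linarith [min_le_right (0 : ℝ) (min (lorQ v v) (2 * C * c - 2 * C * C)), min_le_left (lorQ v v) (2 * C * c - 2 * C * C)])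
  have hx2 : lorQ v x.1 ≤ 2 * C * c - 2 * C * C - 1 := hx.trans (by
    linarith [min_le_right (0 : ℝ) (min (lorQ v v) (2 * C * c - 2 * C * C)), min_le_right (lorQ v v) (2 * C * c - 2 * C * C)])
  obtain ⟨s, hs, hxs⟩ := hC x
  have hC1 := (x.one_le_lorQ s).trans hxs
  have hw : FutureCausal (x.1 - v) := by
    refine futureCausal_of_lorQ_pos (y := x) ?_ ?_
    · rw [lorQ_sub_self, x.lorQ_self, lorQ_comm x.1]; linarith
    · rw [map_sub, LinearMap.sub_apply, x.lorQ_self]; linarith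
  have h1 := _root_.lorQ_nonneg hw (Hyp.futureCausal_smul_sub hxs)
  simp only [map_sub, map_smul, LinearMap.sub_apply, smul_eq_mul, x.lorQ_self] at h1
  have h2 := hv s hs
  nlinarith

theorem IsNet.futureCausal {n : ℕ} (hn : 1 ≤ n) {S : Set (Hyp n)} (hS : IsNet S)
    {v : Fin (n + 1) → ℝ} {c : ℝ} (hv : ∀ s ∈ S, c ≤ lorQ v s.1) : FutureCausal v :=
  futureCausal_of_forall_nonneg (hS.lorQ_nonneg hn hv)

/-- A light-like `v` has values tending to `0` on points running into its ideal endpoint, and the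
points of the net near them then have small values too. -/
theorem IsNet.lorQ_self_pos {n : ℕ} (hn : 1 ≤ n) {S : Set (Hyp n)} (hS : IsNet S)
    {v : Fin (n + 1) → ℝ} {c : ℝ} (hc : 0 < c) (hv : ∀ s ∈ S, c ≤ lorQ v s.1) :
    0 < lorQ v v := by
  have hfc := hS.futureCausal hn hv
  refine hfc.1.lt_of_ne fun h0 => ?_
  obtain ⟨C, hC⟩ := hS
  have p := Hyp.base n
  have hvne : v ≠ 0 := by
    rintro rfl
    obtain ⟨s, hs, -⟩ := hC p
    have := hv s hs
    simp at this
    linarith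
  have hvp : 0 < lorQ v p.1 := by rw [lorQ_comm]; exact p.lorQ_pos hfc hvne
  obtain ⟨s₀, hs₀, hps₀⟩ := hC p
  have hC1 := (p.one_le_lorQ s₀).trans hps₀
  obtain ⟨a, ha0, ha1, ha⟩ : ∃ a : ℝ, 0 < a ∧ a ≤ 1 ∧ 2 * C * (a * lorQ v p.1) < c := by
    have hk : 0 < 2 * C * lorQ v p.1 := by positivity
    refine ⟨min 1 (c / 2 / (2 * C * lorQ v p.1)), by positivity, min_le_left _ _, ?_⟩
    have := min_le_right 1 (c / 2 / (2 * C * lorQ v p.1))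
    rw [le_div_iff₀ hk] at this
    linarith
  -- With `v` light-like, this `b` puts `a • p + b • v` on the hyperboloid, where `v` takes the
  -- small value `a * lorQ v p`.
  set b := (1 - a ^ 2) / (2 * a * lorQ v p.1) with hb
  have hb0 : 0 ≤ b := div_nonneg (by nlinarith) (by positivity)
  have hb1 : 2 * a * b * lorQ v p.1 = 1 - a ^ 2 := by
    rw [hb]; field_simp
  have hq : lorQ (a • p.1 + b • v) (a • p.1 + b • v) = 1 := by
    rw [lorQ_add_self, lorQ_smul_smul, lorQ_smul_smul, lorQ_smul_smul, ← h0, p.lorQ_self,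
      lorQ_comm p.1]
    linarith
  have hx0 : 0 < (a • p.1 + b • v) 0 := by
    have h1 := mul_pos ha0 p.2.2
    have h2 := mul_nonneg hb0 hfc.2
    simp only [Pi.add_apply, Pi.smul_apply, smul_eq_mul]
    linarith
  let x : Hyp n := ⟨a • p.1 + b • v, by rw [lorQ_eq_neg_lor] at hq; linarith, hx0⟩
  obtain ⟨s, hs, hxs⟩ := hC x
  rw [lorQ_comm] at hxs
  have h1 := hfc.lorQ_le hxs
  have h2 : lorQ v x.1 = a * lorQ v p.1 := by
    change lorQ v (a • p.1 + b • v) = _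
    simp [← h0]
  rw [h2] at h1
  linarith [hv s hs]

/-! ### Cones over finite subsets of hyperbolic space -/

theorem exists_eq_lorQ {n : ℕ} (g : (Fin (n + 1) → ℝ) →ₗ[ℝ] ℝ) : ∃ w, g = lorQ w := by
  refine ⟨Fin.cons (g (Pi.single 0 1)) fun i => -g (Pi.single i.succ 1), ?_⟩
  ext x
  rw [LinearMap.coe_comp, Function.comp_apply, LinearMap.coe_comp, Function.comp_apply,
    LinearMap.coe_single, lorQ_apply]
  refine Fin.cases ?_ (fun j => ?_) x
  · simp
  · simp [Pi.single_apply]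

theorem lorQ_ne_zero {n : ℕ} {v : Fin (n + 1) → ℝ} (hv : v ≠ 0) : lorQ v ≠ 0 := by
  intro h
  refine hv (funext fun i => ?_)
  refine Fin.cases ?_ (fun j => ?_) i
  · simpa [lorQ_apply] using LinearMap.congr_fun h (Pi.single 0 1)
  · simpa [lorQ_apply, Pi.single_apply] using LinearMap.congr_fun h (Pi.single j.succ 1)

theorem FutureCausal.add {n : ℕ} {x y : Fin (n + 1) → ℝ} (hx : FutureCausal x)
    (hy : FutureCausal y) : FutureCausal (x + y) :=
  ⟨by rw [lorQ_add_self]; linarith [hx.1, hy.1, _root_.lorQ_nonneg hx hy],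
    add_nonneg hx.2 hy.2⟩

theorem FutureCausal.smul {n : ℕ} {x : Fin (n + 1) → ℝ} (hx : FutureCausal x) {a : ℝ}
    (ha : 0 ≤ a) : FutureCausal (a • x) :=
  ⟨by rw [lorQ_smul_smul]; exact mul_nonneg (mul_self_nonneg _) hx.1, mul_nonneg ha hx.2⟩

/-- The cone in `ℝⁿ⁺¹` generated by a subset of `ℍⁿ`. -/
noncomputable def lcone {n : ℕ} (T : Set (Hyp n)) : PointedCone ℝ (Fin (n + 1) → ℝ) :=
  PointedCone.hull ℝ ((fun x : Hyp n => x.1) '' T)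

theorem lcone_induction {n : ℕ} {T : Set (Hyp n)} {p : (Fin (n + 1) → ℝ) → Prop}
    (mem : ∀ t ∈ T, p t.1) (zero : p 0) (add : ∀ x y, p x → p y → p (x + y))
    (smul : ∀ (a : ℝ) x, 0 < a → p x → p (a • x)) {x : Fin (n + 1) → ℝ} (hx : x ∈ lcone T) :
    p x := by
  refine Submodule.span_induction (p := fun x _ => p x) ?_ zero (fun x y _ _ => add x y) ?_ hx
  · rintro _ ⟨t, ht, rfl⟩
    exact mem t ht
  · rintro ⟨a, ha⟩ x _ hx
    rw [Nonneg.mk_smul]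
    rcases ha.eq_or_lt with rfl | h
    · rwa [zero_smul]
    · exact smul a x h hx

theorem mem_lcone_of_mem {n : ℕ} {T : Set (Hyp n)} {t : Hyp n} (ht : t ∈ T) : t.1 ∈ lcone T :=
  Submodule.subset_span ⟨t, ht, rfl⟩

theorem smul_mem_lcone {n : ℕ} {T : Set (Hyp n)} {x : Fin (n + 1) → ℝ} (hx : x ∈ lcone T)
    {a : ℝ} (ha : 0 ≤ a) : a • x ∈ lcone T :=
  PointedCone.smul_mem _ ha hx

theorem lcone_mono {n : ℕ} {T T' : Set (Hyp n)} (h : T ⊆ T') : lcone T ≤ lcone T' :=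
  Submodule.span_mono (Set.image_mono h)

theorem nonneg_of_mem_lcone {n : ℕ} {T : Set (Hyp n)} {g : (Fin (n + 1) → ℝ) →ₗ[ℝ] ℝ}
    (hg : ∀ t ∈ T, 0 ≤ g t.1) {x : Fin (n + 1) → ℝ} (hx : x ∈ lcone T) : 0 ≤ g x := by
  refine lcone_induction (p := fun x => 0 ≤ g x) hg (by simp) (fun x y hx hy => ?_)
    (fun a x ha hx => ?_) hx
  · rw [map_add]; exact add_nonneg hx hy
  · rw [map_smul]; exact mul_nonneg ha.le hx

/-- A sum of nonnegative terms vanishes only if each term does, so the induction must carry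
nonnegativity along. -/
theorem mem_lcone_sep {n : ℕ} {T : Set (Hyp n)} {g : (Fin (n + 1) → ℝ) →ₗ[ℝ] ℝ}
    (hg : ∀ t ∈ T, 0 ≤ g t.1) {x : Fin (n + 1) → ℝ} (hx : x ∈ lcone T) (h0 : g x = 0) :
    x ∈ lcone {t ∈ T | g t.1 = 0} := by
  refine (lcone_induction (p := fun x => 0 ≤ g x ∧ (g x = 0 → x ∈ lcone {t ∈ T | g t.1 = 0}))
    (fun t ht => ⟨hg t ht, fun h => mem_lcone_of_mem ⟨ht, h⟩⟩) ⟨by simp, fun _ => zero_mem _⟩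
    (fun x y hx hy => ?_) (fun a x ha hx => ?_) hx).2 h0
  · rw [map_add]
    refine ⟨add_nonneg hx.1 hy.1, fun h => add_mem (hx.2 ?_) (hy.2 ?_)⟩ <;>
      linarith [hx.1, hy.1]
  · rw [map_smul, smul_eq_mul]
    refine ⟨mul_nonneg ha.le hx.1, fun h => smul_mem_lcone (hx.2 ?_) ha.le⟩
    exact (mul_eq_zero.1 h).resolve_left ha.ne'

theorem exists_smul_of_mem_lcone {n : ℕ} {T : Set (Hyp n)} {A : Set (Fin (n + 1) → ℝ)}
    (hA : Convex ℝ A) (hT : ∀ t ∈ T, t.1 ∈ A) {x : Fin (n + 1) → ℝ} (hx : x ∈ lcone T) :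
    x = 0 ∨ ∃ a : ℝ, 0 < a ∧ ∃ z ∈ A, x = a • z := by
  refine lcone_induction (p := fun x => x = 0 ∨ ∃ a : ℝ, 0 < a ∧ ∃ z ∈ A, x = a • z)
    (fun t ht => Or.inr ⟨1, one_pos, t.1, hT t ht, (one_smul _ _).symm⟩) (Or.inl rfl) ?_ ?_ hx
  · rintro x y (rfl | ⟨a, ha, z, hz, rfl⟩) hy
    · rwa [zero_add]
    · rcases hy with rfl | ⟨b, hb, w, hw, rfl⟩
      · rw [add_zero]; exact Or.inr ⟨a, ha, z, hz, rfl⟩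
      · refine Or.inr ⟨a + b, by positivity, (a / (a + b)) • z + (b / (a + b)) • w,
          hA hz hw (by positivity) (by positivity) (by field_simp), ?_⟩
        have : a + b ≠ 0 := by positivity
        rw [smul_add, smul_smul, smul_smul, mul_div_cancel₀ _ this, mul_div_cancel₀ _ this]
  · rintro b x hb (rfl | ⟨a, ha, z, hz, rfl⟩)
    · simp
    · exact Or.inr ⟨b * a, by positivity, z, hz, by rw [smul_smul]⟩

theorem exists_lorQ_neg_of_notMem_lcone {n : ℕ} {T : Set (Hyp n)} (hT : T.Finite)
    {x : Fin (n + 1) → ℝ} (hx : x ∉ lcone T) :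
    ∃ w, lorQ w x < 0 ∧ ∀ t ∈ T, 0 ≤ lorQ w t.1 := by
  obtain ⟨G, -, hG⟩ := exists_finite_halfSpaces_hull (hT.image (fun x : Hyp n => x.1))
  obtain ⟨g, hg, hgx⟩ : ∃ g ∈ G, g x < 0 := by
    by_contra! h
    exact hx ((hG x).2 h)
  obtain ⟨w, rfl⟩ := exists_eq_lorQ g
  exact ⟨w, hgx, fun t ht => (hG _).1 (mem_lcone_of_mem ht) _ hg⟩

/-- The part of hyperbolic space in the cone generated by `T`. -/
def coneCell {n : ℕ} (T : Set (Hyp n)) : Set (Hyp n) := {x | x.1 ∈ lcone T}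

theorem subset_coneCell {n : ℕ} (T : Set (Hyp n)) : T ⊆ coneCell T :=
  fun _ ht => mem_lcone_of_mem ht

theorem exists_finite_halfSpaces_coneCell {n : ℕ} {T : Set (Hyp n)} (hT : T.Finite) :
    ∃ G : Set ((Fin (n + 1) → ℝ) →ₗ[ℝ] ℝ), G.Finite ∧
      coneCell T = ⋂ g ∈ G, {x : Hyp n | 0 ≤ g x.1} := by
  obtain ⟨G, hG, h⟩ := exists_finite_halfSpaces_hull (hT.image (fun x : Hyp n => x.1))
  refine ⟨G, hG, ?_⟩
  ext x
  simp only [Set.mem_iInter]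
  exact h x.1

/-- A linear functional that vanishes nowhere on `ℍⁿ` has constant sign there. -/
theorem nonneg_of_ne_zero {n : ℕ} {g : (Fin (n + 1) → ℝ) →ₗ[ℝ] ℝ}
    (h : ∀ x : Hyp n, g x.1 ≠ 0) {p : Hyp n} (hp : 0 ≤ g p.1) (q : Hyp n) : 0 ≤ g q.1 := by
  by_contra! hq
  have hp' : 0 < g p.1 := hp.lt_of_ne (h p).symm
  -- A positive combination of `p` and `q` annihilated by `g`; normalised, it is a zero of `g` on
  -- the geodesic between them.
  set z := g p.1 • q.1 + (-g q.1) • p.1 with hz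
  have hpq := q.one_le_lorQ p
  have hzz : 0 < lorQ z z := by
    rw [hz, lorQ_add_self, lorQ_smul_smul, lorQ_smul_smul, lorQ_smul_smul, p.lorQ_self,
      q.lorQ_self]
    have := mul_pos hp' (neg_pos.2 hq)
    nlinarith
  have hz0 : 0 < z 0 := by
    have h1 := mul_pos hp' q.2.2
    have h2 := mul_pos (neg_pos.2 hq) p.2.2
    simp only [hz, Pi.add_apply, Pi.smul_apply, smul_eq_mul]
    linarith
  obtain ⟨x, hx⟩ := exists_eq_smul_hyp hzz hz0
  have hgz : g z = 0 := by
    rw [hz, map_add, map_smul, map_smul]; simp; ring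
  rw [hx, map_smul, smul_eq_mul, mul_eq_zero] at hgz
  exact hgz.elim (Real.sqrt_pos.2 hzz).ne' (h x)

/-- Minkowski–Weyl gives finitely many functionals. Those that are zero or vanish nowhere on `ℍⁿ`
define no half-space, but impose no condition either, being nonnegative at a point of `T`. -/
theorem isHPolyhedron_coneCell {n : ℕ} {T : Set (Hyp n)} (hT : T.Finite) (hne : T.Nonempty) :
    IsHPolyhedron (coneCell T) := by
  obtain ⟨G, hG, h⟩ := exists_finite_halfSpaces_coneCell hT
  obtain ⟨p, hp⟩ := hne
  have hpG := subset_coneCell T hp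
  rw [h, Set.mem_iInter₂] at hpG
  let φ : ((Fin (n + 1) → ℝ) →ₗ[ℝ] ℝ) → Set (Hyp n) × Set (Hyp n) :=
    fun g => ({x | 0 ≤ g x.1}, {x | g x.1 = 0})
  have hfin : (φ '' {g ∈ G | g ≠ 0 ∧ ∃ x : Hyp n, g x.1 = 0}).Finite :=
    (hG.subset (Set.sep_subset _ _)).image _
  refine ⟨φ '' {g ∈ G | g ≠ 0 ∧ ∃ x : Hyp n, g x.1 = 0}, ?_, ?_, ?_⟩
  · rintro _ ⟨g, ⟨-, hg0, x, hx⟩, rfl⟩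
    exact ⟨g, hg0, ⟨x, hx⟩, rfl, rfl⟩
  · have : Finite (Prod.snd '' (φ '' {g ∈ G | g ≠ 0 ∧ ∃ x : Hyp n, g x.1 = 0})) :=
      (hfin.image _).to_subtype
    exact locallyFinite_of_finite _
  · rw [h]
    ext x
    simp only [Set.mem_iInter, Set.forall_mem_image]
    constructor
    · exact fun hx g hg => hx g hg.1
    · intro hx g hg
      by_cases hg0 : g = 0
      · simp [hg0]
      by_cases hex : ∃ x : Hyp n, g x.1 = 0
      · exact hx ⟨hg, hg0, hex⟩
      · push Not at hex
        exact nonneg_of_ne_zero hex (hpG g hg) x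

/-- Minkowski–Weyl makes the cell closed. Conversely, by induction on the cone, each nonzero element
is a positive multiple of a point of any convex set containing `T`. -/
theorem hHull_eq_coneCell {n : ℕ} {T : Set (Hyp n)} (hT : T.Finite) :
    hHull T = coneCell T := by
  refine Set.Subset.antisymm (Set.sInter_subset_of_mem ⟨?_, ?_, subset_coneCell T⟩) ?_
  · obtain ⟨G, -, h⟩ := exists_finite_halfSpaces_coneCell hT
    rw [h]
    refine isClosed_biInter fun g _ => isClosed_le continuous_const ?_
    exact g.continuous_of_finiteDimensional.comp continuous_subtype_val
  · rintro x hx y hy z ⟨a, b, ha, hb, hz⟩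
    change z.1 ∈ lcone T
    rw [hz]
    exact add_mem (smul_mem_lcone hx ha) (smul_mem_lcone hy hb)
  · rintro x hx C ⟨-, hC, hTC⟩
    have key : x.1 = 0 ∨ ∃ a : ℝ, 0 < a ∧ ∃ z ∈ C, x.1 = a • z.1 := by
      refine lcone_induction (p := fun x => x = 0 ∨ ∃ a : ℝ, 0 < a ∧ ∃ z ∈ C, x = a • z.1)
        (fun t ht => Or.inr ⟨1, one_pos, t, hTC ht, (one_smul _ _).symm⟩) (Or.inl rfl) ?_ ?_ hx
      · rintro x y (rfl | ⟨a, ha, z, hz, rfl⟩) hy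
        · rwa [zero_add]
        · rcases hy with rfl | ⟨b, hb, w, hw, rfl⟩
          · rw [add_zero]; exact Or.inr ⟨a, ha, z, hz, rfl⟩
          · have h1 := z.one_le_lorQ w
            obtain ⟨u, hu⟩ := exists_eq_smul_hyp (w := a • z.1 + b • w.1) (by
              rw [lorQ_add_self, lorQ_smul_smul, lorQ_smul_smul, lorQ_smul_smul, z.lorQ_self,
                w.lorQ_self]
              positivity) (by
              have := z.2.2
              have := w.2.2
              simp only [Pi.add_apply, Pi.smul_apply, smul_eq_mul]
              positivity)
            set k := √(lorQ (a • z.1 + b • w.1) (a • z.1 + b • w.1))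
            have hk : 0 < k := by
              refine (Real.sqrt_nonneg _).lt_of_ne fun h0 => ?_
              have h2 : (a • z.1 + b • w.1) 0 = 0 := by
                rw [hu]
                rw [show k = 0 from h0.symm]; simp
              have h3 := mul_pos ha z.2.2
              have h4 := mul_pos hb w.2.2
              simp only [Pi.add_apply, Pi.smul_apply, smul_eq_mul] at h2
              linarith
            refine Or.inr ⟨k, hk, u, hC z hz w hw ⟨k⁻¹ * a, k⁻¹ * b, by positivity,
              by positivity, ?_⟩, hu⟩
            rw [← smul_smul, ← smul_smul, ← smul_add, hu, smul_smul, inv_mul_cancel₀ hk.ne',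
              one_smul]
      · rintro b x hb (rfl | ⟨a, ha, z, hz, rfl⟩)
        · simp
        · exact Or.inr ⟨b * a, by positivity, z, hz, by rw [smul_smul]⟩
    obtain ⟨a, ha, z, hz, hxz⟩ := key.resolve_left x.ne_zero
    have h1 := x.lorQ_self
    rw [hxz, lorQ_smul_smul, z.lorQ_self, mul_one] at h1
    have ha1 : a = 1 := by nlinarith
    rw [ha1, one_smul] at hxz
    rwa [Subtype.ext hxz]

/-! ### Delone sets and their supporting vectors -/

/-- A Delone set: it meets every ball of some fixed radius, and is finite in bounded regions. -/
structure IsDelone {n : ℕ} (S : Set (Hyp n)) : Prop where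
  net : IsNet S
  finite : ∀ M : ℝ, {s ∈ S | s.1 0 ≤ M}.Finite

/-- The vectors `v` with `-(v ∘ s) ≥ 1` for all `s ∈ S`. -/
def supportVectors {n : ℕ} (S : Set (Hyp n)) : Set (Fin (n + 1) → ℝ) :=
  {v | ∀ s ∈ S, 1 ≤ lorQ v s.1}

/-- The points of `S` on the hyperplane `-(v ∘ x) = 1`. -/
def contacts {n : ℕ} (S : Set (Hyp n)) (v : Fin (n + 1) → ℝ) : Set (Hyp n) :=
  {s ∈ S | lorQ v s.1 = 1}

/-- The time coordinate is the pairing with the base point, which is comparable to the pairing with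
the point of `ℍⁿ` on the ray of `v`. -/
theorem exists_time_le_lorQ {n : ℕ} {v : Fin (n + 1) → ℝ} (hv : 0 < lorQ v v) (hv0 : 0 < v 0) :
    ∃ C : ℝ, 0 < C ∧ ∀ z, FutureCausal z → z 0 ≤ C * lorQ v z := by
  obtain ⟨c, hc⟩ := exists_eq_smul_hyp hv hv0
  set m := √(lorQ v v)
  have hm : 0 < m := Real.sqrt_pos.2 hv
  have h1 := (Hyp.base n).one_le_lorQ c
  refine ⟨2 * lorQ (Hyp.base n).1 c.1 / m, by positivity, fun z hz => ?_⟩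
  have h2 := hz.lorQ_le (le_refl (lorQ (Hyp.base n).1 c.1))
  rw [lorQ_base] at h2
  refine h2.trans (le_of_eq ?_)
  rw [hc, map_smul, LinearMap.smul_apply, smul_eq_mul, lorQ_comm c.1 z]
  field_simp

theorem exists_abs_lorQ_le_time {n : ℕ} (w : Fin (n + 1) → ℝ) :
    ∃ C : ℝ, 0 < C ∧ ∀ z, FutureCausal z → |lorQ w z| ≤ C * z 0 := by
  refine ⟨∑ i, |w i| + 1, by positivity, fun z hz => ?_⟩
  have h1 : |lorQ w z| ≤ ∑ i, |w i| * |z i| := by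
    rw [lorQ_apply, Fin.sum_univ_succ]
    refine (abs_sub _ _).trans (add_le_add (abs_mul _ _).le ?_)
    exact (Finset.abs_sum_le_sum_abs _ _).trans (Finset.sum_le_sum fun i _ => (abs_mul _ _).le)
  have h2 : ∑ i, |w i| * |z i| ≤ (∑ i, |w i|) * z 0 := by
    rw [Finset.sum_mul]
    exact Finset.sum_le_sum fun i _ =>
      mul_le_mul_of_nonneg_left (hz.abs_apply_le i) (abs_nonneg _)
  linarith [hz.2]

namespace IsDelone

variable {n : ℕ} {S : Set (Hyp n)}

theorem nonempty (hS : IsDelone S) : S.Nonempty := by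
  obtain ⟨C, hC⟩ := hS.net
  obtain ⟨s, hs, -⟩ := hC (Hyp.base n)
  exact ⟨s, hs⟩

theorem ne_zero (hS : IsDelone S) {v : Fin (n + 1) → ℝ} (hv : v ∈ supportVectors S) : v ≠ 0 := by
  rintro rfl
  obtain ⟨s, hs⟩ := hS.nonempty
  have := hv s hs
  simp at this
  linarith

theorem futureCausal (hS : IsDelone S) (hn : 1 ≤ n) {v : Fin (n + 1) → ℝ}
    (hv : v ∈ supportVectors S) : FutureCausal v :=
  hS.net.futureCausal hn hv

theorem lorQ_self_pos (hS : IsDelone S) (hn : 1 ≤ n) {v : Fin (n + 1) → ℝ}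
    (hv : v ∈ supportVectors S) : 0 < lorQ v v :=
  hS.net.lorQ_self_pos hn one_pos hv

theorem time_pos (hS : IsDelone S) (hn : 1 ≤ n) {v : Fin (n + 1) → ℝ}
    (hv : v ∈ supportVectors S) : 0 < v 0 :=
  (hS.futureCausal hn hv).time_pos (hS.ne_zero hv)

theorem finite_lorQ_le (hS : IsDelone S) (hn : 1 ≤ n) {v : Fin (n + 1) → ℝ}
    (hv : v ∈ supportVectors S) (M : ℝ) : {s ∈ S | lorQ v s.1 ≤ M}.Finite := by
  obtain ⟨C, hC, h⟩ := exists_time_le_lorQ (hS.lorQ_self_pos hn hv) (hS.time_pos hn hv)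
  refine (hS.finite (C * M)).subset fun s hs => ⟨hs.1, (h s.1 s.futureCausal).trans ?_⟩
  exact mul_le_mul_of_nonneg_left hs.2 hC.le

theorem finite_contacts (hS : IsDelone S) (hn : 1 ≤ n) {v : Fin (n + 1) → ℝ}
    (hv : v ∈ supportVectors S) : (contacts S v).Finite :=
  (hS.finite_lorQ_le hn hv 1).subset fun _ hs => ⟨hs.1, hs.2.le⟩

/-- A supporting vector can be moved a little in every direction that is non-negative on its
contact points. -/
theorem exists_perturbation (hS : IsDelone S) (hn : 1 ≤ n) {v w : Fin (n + 1) → ℝ}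
    (hv : v ∈ supportVectors S) (hw : ∀ t ∈ contacts S v, 0 ≤ lorQ w t.1) :
    ∃ ε : ℝ, 0 < ε ∧ v + ε • w ∈ supportVectors S ∧
      contacts S (v + ε • w) = {t ∈ contacts S v | lorQ w t.1 = 0} := by
  obtain ⟨C₁, hC₁, h₁⟩ := exists_time_le_lorQ (hS.lorQ_self_pos hn hv) (hS.time_pos hn hv)
  obtain ⟨C₂, hC₂, h₂⟩ := exists_abs_lorQ_le_time w
  have hbd : ∀ s : Hyp n, -(C₂ * C₁ * lorQ v s.1) ≤ lorQ w s.1 := fun s => by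
    have e1 := h₁ s.1 s.futureCausal
    have e2 := (abs_le.1 (h₂ s.1 s.futureCausal)).1
    have e3 := mul_le_mul_of_nonneg_left e1 hC₂.le
    linarith
  -- Only finitely many points of `S` have value at most `2`, so the values other than `1` keep a
  -- distance from `1`.
  obtain ⟨δ, hδ, hδS⟩ : ∃ δ : ℝ, 0 < δ ∧ ∀ s ∈ S, lorQ v s.1 ≠ 1 → 1 + δ ≤ lorQ v s.1 := by
    have hfin : (insert 2 ((fun s : Hyp n => lorQ v s.1) ''
        {s ∈ S | lorQ v s.1 ≤ 2 ∧ lorQ v s.1 ≠ 1})).Finite :=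
      (((hS.finite_lorQ_le hn hv 2).subset fun s hs => ⟨hs.1, hs.2.1⟩).image _).insert _
    obtain ⟨a, ha, hmin⟩ := hfin.exists_minimal ⟨2, Set.mem_insert _ _⟩
    have hmin' : ∀ b ∈ (insert 2 ((fun s : Hyp n => lorQ v s.1) ''
        {s ∈ S | lorQ v s.1 ≤ 2 ∧ lorQ v s.1 ≠ 1})), a ≤ b := fun b hb => by
      rcases le_total a b with h | h
      · exact h
      · exact hmin hb h
    have ha1 : 1 < a := by
      rcases ha with rfl | ⟨s, hs, rfl⟩
      · norm_num
      · exact lt_of_le_of_ne (hv s hs.1) hs.2.2.symm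
    refine ⟨a - 1, by linarith, fun s hs hs1 => ?_⟩
    rcases le_total (lorQ v s.1) 2 with h | h
    · linarith [hmin' _ (Or.inr ⟨s, ⟨hs, h, hs1⟩, rfl⟩)]
    · linarith [hmin' 2 (Set.mem_insert _ _)]
  set K := C₂ * C₁ with hK
  have hK0 : 0 < K := by positivity
  -- Off the contacts the new value is at least `(1 - ε * K) * (1 + δ) = 1 + δ / 2`.
  set ε := δ / (2 * K * (1 + δ)) with hε
  have hε0 : 0 < ε := by positivity
  have hεK : ε * K * (1 + δ) = δ / 2 := by rw [hε]; field_simp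
  have hlt : ∀ s ∈ S, lorQ v s.1 ≠ 1 → 1 < lorQ (v + ε • w) s.1 := fun s hs hs1 => by
    have e1 := hδS s hs hs1
    have e2 := mul_le_mul_of_nonneg_left (hbd s) hε0.le
    simp only [map_add, map_smul, LinearMap.add_apply, LinearMap.smul_apply, smul_eq_mul]
    have e3 : ε * K < 1 := by nlinarith [mul_pos hε0 hK0]
    nlinarith [mul_le_mul_of_nonneg_left e1 (sub_pos.2 e3).le]
  refine ⟨ε, hε0, fun s hs => ?_, ?_⟩
  · by_cases h1 : lorQ v s.1 = 1
    · have := mul_nonneg hε0.le (hw s ⟨hs, h1⟩)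
      simp only [map_add, map_smul, LinearMap.add_apply, LinearMap.smul_apply, smul_eq_mul]
      linarith
    · exact (hlt s hs h1).le
  · ext s
    constructor
    · rintro ⟨hs, h⟩
      have h1 : lorQ v s.1 = 1 := by
        by_contra h1
        exact (hlt s hs h1).ne' h
      refine ⟨⟨hs, h1⟩, ?_⟩
      simp only [map_add, map_smul, LinearMap.add_apply, LinearMap.smul_apply, smul_eq_mul, h1]
        at h
      exact (mul_eq_zero.1 (by linarith : ε * lorQ w s.1 = 0)).resolve_left hε0.ne'
    · rintro ⟨⟨hs, h1⟩, h0⟩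
      refine ⟨hs, ?_⟩
      simp [h1, h0]

/-! ### Cells -/

theorem le_of_mem_eHull {f : (Fin (n + 1) → ℝ) →ₗ[ℝ] ℝ} {c : ℝ} (hf : ∀ s ∈ S, c ≤ f s.1)
    {x : Fin (n + 1) → ℝ} (hx : x ∈ eHull S) : c ≤ f x := by
  have hsub : eHull S ⊆ {x | c ≤ f x} := by
    refine closedConvexHull_min ?_ (convex_halfSpace_ge f.isLinear c)
      (isClosed_le continuous_const f.continuous_of_finiteDimensional)
    rintro _ ⟨s, hs, rfl⟩
    exact hf s hs
  exact hsub hx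

theorem mem_lcone_contacts (hS : IsDelone S) (hn : 1 ≤ n) {v : Fin (n + 1) → ℝ}
    (hv : v ∈ supportVectors S) {x : Fin (n + 1) → ℝ}
    (hx : ∀ v' ∈ supportVectors S, lorQ v x ≤ lorQ v' x) : x ∈ lcone (contacts S v) := by
  by_contra h
  obtain ⟨w, hwx, hw⟩ := exists_lorQ_neg_of_notMem_lcone (hS.finite_contacts hn hv) h
  obtain ⟨ε, hε, hv', -⟩ := hS.exists_perturbation hn hv hw
  have := hx _ hv'
  simp only [map_add, map_smul, LinearMap.add_apply, LinearMap.smul_apply, smul_eq_mul] at this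
  nlinarith

end IsDelone

theorem lorQ_sub_nonneg_of_mem_contacts {n : ℕ} {S : Set (Hyp n)} {v v' : Fin (n + 1) → ℝ}
    (hv' : v' ∈ supportVectors S) : ∀ t ∈ contacts S v, 0 ≤ lorQ (v' - v) t.1 := fun t ht => by
  rw [map_sub, LinearMap.sub_apply, ht.2, sub_nonneg]
  exact hv' t ht.1

theorem lorQ_le_of_mem_lcone_contacts {n : ℕ} {S : Set (Hyp n)} {v v' x : Fin (n + 1) → ℝ}
    (hv' : v' ∈ supportVectors S) (hx : x ∈ lcone (contacts S v)) : lorQ v x ≤ lorQ v' x := by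
  have := nonneg_of_mem_lcone (lorQ_sub_nonneg_of_mem_contacts hv') hx
  rwa [map_sub, LinearMap.sub_apply, sub_nonneg] at this

/-- For `x = ∑ aᵢ tᵢ` the right side is `∑ aᵢ aⱼ lorQ tᵢ tⱼ ≥ (∑ aᵢ) ^ 2`, and `∑ aᵢ = lorQ v x`.
Consequently a cell stays inside the closed ball whose sphere carries its contacts. -/
theorem sq_lorQ_le_of_mem_lcone_contacts {n : ℕ} {S : Set (Hyp n)} {v x : Fin (n + 1) → ℝ}
    (hx : x ∈ lcone (contacts S v)) : lorQ v x ^ 2 ≤ lorQ x x := by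
  have h1 : ∀ t ∈ contacts S v, 0 ≤ (lorQ x - lorQ v x • lorQ v) t.1 := fun t ht => by
    have h2 : ∀ t' ∈ contacts S v, 0 ≤ (lorQ t.1 - lorQ v) t'.1 := fun t' ht' => by
      rw [LinearMap.sub_apply, ht'.2, sub_nonneg]
      exact t.one_le_lorQ t'
    have h3 := nonneg_of_mem_lcone h2 hx
    simp only [LinearMap.sub_apply, LinearMap.smul_apply, smul_eq_mul, ht.2, mul_one] at h3 ⊢
    rwa [lorQ_comm x]
  have h2 := nonneg_of_mem_lcone h1 hx
  simp only [LinearMap.sub_apply, LinearMap.smul_apply, smul_eq_mul] at h2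
  linarith [pow_two (lorQ v x)]

theorem lorQ_pos_of_mem_coneCell {n : ℕ} {S : Set (Hyp n)} {v : Fin (n + 1) → ℝ} {x : Hyp n}
    (hx : x ∈ coneCell (contacts S v)) : 0 < lorQ v x.1 := by
  have h1 : ∀ t ∈ contacts S v, 0 ≤ lorQ v t.1 := fun t ht => by rw [ht.2]; norm_num
  refine (nonneg_of_mem_lcone h1 hx).lt_of_ne fun h0 => x.ne_zero ?_
  have h2 := mem_lcone_sep h1 hx h0.symm
  have : {t ∈ contacts S v | lorQ v t.1 = 0} = ∅ := by
    ext t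
    simp only [Set.mem_sep_iff, Set.mem_empty_iff_false, iff_false, not_and]
    intro ht
    rw [ht.2]
    norm_num
  rw [this, lcone, Set.image_empty, PointedCone.hull, Submodule.span_empty] at h2
  exact h2

theorem lorQ_le_one_of_mem_coneCell {n : ℕ} {S : Set (Hyp n)} {v : Fin (n + 1) → ℝ} {x : Hyp n}
    (hx : x ∈ coneCell (contacts S v)) : lorQ v x.1 ≤ 1 := by
  have h1 := sq_lorQ_le_of_mem_lcone_contacts hx
  rw [x.lorQ_self] at h1
  nlinarith

theorem contacts_nonempty_of_mem {n : ℕ} {S : Set (Hyp n)} {v x : Fin (n + 1) → ℝ}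
    (hx : x ∈ lcone (contacts S v)) (hne : x ≠ 0) : (contacts S v).Nonempty := by
  by_contra h
  rw [Set.not_nonempty_iff_eq_empty.1 h, lcone, Set.image_empty, PointedCone.hull,
    Submodule.span_empty] at hx
  exact hne hx

theorem val_mem_eHull {n : ℕ} {S : Set (Hyp n)} {s : Hyp n} (hs : s ∈ S) : s.1 ∈ eHull S :=
  subset_closedConvexHull ⟨s, hs, rfl⟩

/-- The cone over the contact points, cut by the supporting plane, lies in the hull. -/
theorem mem_eHull_of_mem_lcone_contacts {n : ℕ} {S : Set (Hyp n)} {v x : Fin (n + 1) → ℝ}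
    (hx : x ∈ lcone (contacts S v)) (h1 : lorQ v x = 1) : x ∈ eHull S := by
  have hconv : Convex ℝ (eHull S ∩ {z | lorQ v z = 1}) :=
    convex_closedConvexHull.inter (convex_hyperplane (lorQ v).isLinear 1)
  rcases exists_smul_of_mem_lcone hconv (fun t ht => ⟨val_mem_eHull ht.1, ht.2⟩) hx with
    rfl | ⟨a, -, z, ⟨hz, hvz⟩, rfl⟩
  · simp at h1
  · rw [map_smul, hvz, smul_eq_mul, mul_one] at h1
    rwa [h1, one_smul]

/-- The Delaunay cells are the hyperbolic parts of the cones over the contact sets. -/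
theorem mem_Delaunay_iff {n : ℕ} (hn : 1 ≤ n) {S : Set (Hyp n)} (hS : IsDelone S)
    {D : Set (Hyp n)} : D ∈ Delaunay S ↔
      ∃ v ∈ supportVectors S, (contacts S v).Nonempty ∧ D = coneCell (contacts S v) := by
  have key : ∀ v ∈ supportVectors S,
      radial '' ((fun x : upperRegion n => x.1) ⁻¹' (eHull S ∩ {x | lorQ v x = 1})) =
        coneCell (contacts S v) := by
    intro v hv
    ext y
    constructor
    · rintro ⟨x, ⟨hx, hvx⟩, rfl⟩
      refine smul_mem_lcone (hS.mem_lcone_contacts hn hv fun v' hv' => ?_)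
        (inv_nonneg.2 (Real.sqrt_nonneg _))
      rw [hvx]
      exact IsDelone.le_of_mem_eHull hv' hx
    · intro hy
      have h0 := lorQ_pos_of_mem_coneCell hy
      have h1 := lorQ_le_one_of_mem_coneCell hy
      set k := lorQ v y.1
      have hv1 : lorQ v (k⁻¹ • y.1) = 1 := by
        rw [map_smul, smul_eq_mul]; exact inv_mul_cancel₀ h0.ne'
      have hq : lor (k⁻¹ • y.1) (k⁻¹ • y.1) = -(k⁻¹) ^ 2 := by
        rw [lor_smul_smul, y.2.1]; ring
      have hk1 : 1 ≤ k⁻¹ := (one_le_inv₀ h0).2 h1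
      refine ⟨⟨k⁻¹ • y.1, ?_, ?_⟩, ⟨mem_eHull_of_mem_lcone_contacts
        (smul_mem_lcone hy (inv_nonneg.2 h0.le)) hv1, hv1⟩, ?_⟩
      · rw [hq]; nlinarith
      · simpa using mul_pos (inv_pos.2 h0) y.2.2
      · refine Subtype.ext ?_
        simp only [radial]
        rw [hq, neg_neg, Real.sqrt_sq (by linarith), smul_smul, inv_inv,
          mul_inv_cancel₀ h0.ne', one_smul]
  constructor
  · rintro ⟨F, ⟨⟨f, c, ⟨hf0, hle, x, hx, hfx⟩, rfl⟩, -⟩, rfl⟩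
    obtain ⟨v, rfl⟩ := exists_eq_lorQ f
    have hvS : ∀ s ∈ S, c ≤ lorQ v s.1 := fun s hs => hle _ (val_mem_eHull hs)
    have hv := hS.net.futureCausal hn hvS
    have hvne : v ≠ 0 := by
      rintro rfl
      exact hf0 (by simp)
    have hxfc : FutureCausal x := futureCausal_of_forall_nonneg fun p => by
      rw [lorQ_comm]
      exact IsDelone.le_of_mem_eHull (fun s _ => lorQ_nonneg p.futureCausal s.futureCausal) hx
    have hx1 : 1 ≤ lorQ (Hyp.base n).1 x :=
      IsDelone.le_of_mem_eHull (fun s _ => (Hyp.base n).one_le_lorQ s) hx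
    have hxne : x ≠ 0 := by
      rintro rfl
      simp at hx1
      linarith
    have hxx : 0 < lorQ x x := by
      have hbig : ∀ p : Hyp n, 1 ≤ lorQ x p.1 := fun p => by
        rw [lorQ_comm]
        exact IsDelone.le_of_mem_eHull (fun s _ => p.one_le_lorQ s) hx
      have := IsDelone.le_of_mem_eHull (f := lorQ x) (fun s _ => hbig s) hx
      linarith
    -- Hull points are time-like and `v` is future causal, so no support plane passes through the
    -- origin and `v` can be rescaled to level `1`.
    have hc : 0 < c := by
      rw [← hfx, lorQ_comm]
      exact lorQ_pos hxx hxfc.2 hv hvne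
    have hv' : c⁻¹ • v ∈ supportVectors S := fun s hs => by
      rw [map_smul, LinearMap.smul_apply, smul_eq_mul, ← div_eq_inv_mul, le_div_iff₀ hc, one_mul]
      exact hvS s hs
    have hset : {z | lorQ v z = c} = {z | lorQ (c⁻¹ • v) z = 1} := by
      ext z
      simp only [Set.mem_ofPred_eq, map_smul, LinearMap.smul_apply, smul_eq_mul]
      rw [← div_eq_inv_mul, div_eq_one_iff_eq hc.ne']
    refine ⟨c⁻¹ • v, hv', ?_, ?_⟩
    · have hx1 : x ∈ {z | lorQ (c⁻¹ • v) z = 1} := hset ▸ (show x ∈ {z | lorQ v z = c} from hfx)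
      rw [Set.mem_ofPred_eq] at hx1
      refine contacts_nonempty_of_mem (hS.mem_lcone_contacts hn hv' fun v' hv'' => ?_) hxne
      rw [hx1]
      exact IsDelone.le_of_mem_eHull hv'' hx
    · rw [hset, key _ hv']
  · rintro ⟨v, hv, ⟨t, ht⟩, rfl⟩
    refine ⟨eHull S ∩ {x | lorQ v x = 1}, ⟨⟨lorQ v, 1, ⟨lorQ_ne_zero (hS.ne_zero hv),
      fun x hx => IsDelone.le_of_mem_eHull hv hx, t.1, val_mem_eHull ht.1, ht.2⟩, rfl⟩, ?_⟩,
      (key v hv).symm⟩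
    rintro x ⟨hx, hvx⟩
    refine ⟨hx, fun a _ ha hax => ?_⟩
    have := IsDelone.le_of_mem_eHull hv hax
    rw [map_smul, hvx, smul_eq_mul, mul_one] at this
    linarith

/-! ### The Delaunay tessellation of a Delone set -/

/-- Faces of cells are cells. -/
theorem mem_Delaunay_of_isHFace {n : ℕ} (hn : 1 ≤ n) {S : Set (Hyp n)} (hS : IsDelone S)
    {C D : Set (Hyp n)} (hC : C ∈ Delaunay S) (hD : IsHFace C D) : D ∈ Delaunay S := by
  obtain ⟨v, hv, -, rfl⟩ := (mem_Delaunay_iff hn hS).1 hC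
  obtain ⟨B, G, ⟨f, -, -, rfl, rfl⟩, hCB, ⟨y, hy, hfy⟩, rfl⟩ := hD
  obtain ⟨w, rfl⟩ := exists_eq_lorQ f
  have hw : ∀ t ∈ contacts S v, 0 ≤ lorQ w t.1 := fun t ht => hCB (subset_coneCell _ ht)
  -- Tilting `v` towards `w` keeps exactly the contacts on the face.
  obtain ⟨ε, -, hv', hc⟩ := hS.exists_perturbation hn hv hw
  refine (mem_Delaunay_iff hn hS).2 ⟨_, hv', ?_, ?_⟩
  · rw [hc]
    by_contra h
    have := mem_lcone_sep hw hy hfy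
    rw [Set.not_nonempty_iff_eq_empty.1 h, lcone, Set.image_empty, PointedCone.hull,
      Submodule.span_empty] at this
    exact y.ne_zero this
  · rw [hc]
    ext x
    constructor
    · rintro ⟨hx, hx0⟩
      exact mem_lcone_sep hw hx hx0
    · intro hx
      refine ⟨lcone_mono (Set.sep_subset _ _) hx, le_antisymm ?_ ?_⟩
      · have := nonneg_of_mem_lcone (g := lorQ (-w)) (fun t ht => by
          rw [map_neg, LinearMap.neg_apply, ht.2, neg_zero]) hx
        simpa using this
      · exact nonneg_of_mem_lcone (fun t ht => ht.2.ge) hx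

/-- Distinct cells that meet do so in a face of the first. -/
theorem isHFace_inter {n : ℕ} (hn : 1 ≤ n) {S : Set (Hyp n)} (hS : IsDelone S)
    {C C' : Set (Hyp n)} (hC : C ∈ Delaunay S) (hC' : C' ∈ Delaunay S) (hne : C ≠ C')
    (h : (C ∩ C').Nonempty) : IsHFace C (C ∩ C') := by
  obtain ⟨v, hv, -, rfl⟩ := (mem_Delaunay_iff hn hS).1 hC
  obtain ⟨v', hv', -, rfl⟩ := (mem_Delaunay_iff hn hS).1 hC'
  -- The functional of `v' - v` is nonnegative on the first cell, and vanishes there precisely where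
  -- `v'` is also a minimiser.
  have hnn := lorQ_sub_nonneg_of_mem_contacts (v := v) hv'
  have heq : coneCell (contacts S v) ∩ coneCell (contacts S v') =
      coneCell (contacts S v) ∩ {x | lorQ (v' - v) x.1 = 0} := by
    ext x
    constructor
    · rintro ⟨hx, hx'⟩
      refine ⟨hx, ?_⟩
      have h1 := lorQ_le_of_mem_lcone_contacts hv' hx
      have h2 := lorQ_le_of_mem_lcone_contacts hv hx'
      rw [Set.mem_ofPred_eq, map_sub, LinearMap.sub_apply]
      linarith
    · rintro ⟨hx, h0⟩
      refine ⟨hx, lcone_mono ?_ (mem_lcone_sep hnn hx h0)⟩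
      rintro t ⟨ht, ht0⟩
      rw [map_sub, LinearMap.sub_apply, ht.2] at ht0
      exact ⟨ht.1, by linarith⟩
  rw [heq] at h ⊢
  refine ⟨{x | 0 ≤ lorQ (v' - v) x.1}, {x | lorQ (v' - v) x.1 = 0},
    ⟨lorQ (v' - v), lorQ_ne_zero fun h0 => hne ?_, h.right, rfl, rfl⟩,
    fun x hx => nonneg_of_mem_lcone hnn hx, h, rfl⟩
  rw [sub_eq_zero.1 h0]

/-- Every point lies in the cell of a supporting vector whose contact points span. -/
theorem exists_mem_coneCell_spanning {n : ℕ} (hn : 1 ≤ n) {S : Set (Hyp n)} (hS : IsDelone S)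
    (x : Hyp n) : ∃ v ∈ supportVectors S, x ∈ coneCell (contacts S v) ∧
      ∀ w, (∀ t ∈ contacts S v, lorQ w t.1 = 0) → w = 0 := by
  have hcont : ∀ y : Fin (n + 1) → ℝ, Continuous fun v => lorQ v y := fun y => by
    simp only [lorQ_comm _ y]
    exact (lorQ y).continuous_of_finiteDimensional
  have hclosed : IsClosed (supportVectors S) := by
    have : supportVectors S = ⋂ s ∈ S, {v | 1 ≤ lorQ v s.1} := by
      ext v; simp [supportVectors]
    rw [this]
    exact isClosed_biInter fun s _ => isClosed_le continuous_const (hcont s.1)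
  set C := lorQ (Hyp.base n).1 x.1
  have hC : 1 ≤ C := (Hyp.base n).one_le_lorQ x
  -- A future causal vector is bounded by its time coordinate, hence by its value at `x`. The cutoff
  -- `x.1 0` is the value of the base point, itself a supporting vector.
  have hK : IsCompact (supportVectors S ∩ {v | lorQ v x.1 ≤ x.1 0}) := by
    refine IsCompact.of_isClosed_subset (isCompact_univ_pi fun _ : Fin (n + 1) =>
      isCompact_Icc (a := -(2 * C * x.1 0)) (b := 2 * C * x.1 0))
      (hclosed.inter (isClosed_le (hcont x.1) continuous_const)) ?_
    rintro v ⟨hv, hvx⟩ i -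
    have hfc := hS.futureCausal hn hv
    have h1 := hfc.lorQ_le (le_refl C)
    rw [lorQ_base] at h1
    rw [Set.mem_Icc, ← abs_le]
    refine (hfc.abs_apply_le i).trans (h1.trans ?_)
    exact mul_le_mul_of_nonneg_left hvx (by linarith)
  have hbase : (Hyp.base n).1 ∈ supportVectors S := fun s _ => (Hyp.base n).one_le_lorQ s
  have hbx : lorQ (Hyp.base n).1 x.1 ≤ x.1 0 := by rw [lorQ_comm, lorQ_base]
  obtain ⟨v₀, hv₀, hmin⟩ := hK.exists_isMinOn ⟨_, hbase, hbx⟩ (hcont x.1).continuousOn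
  have hmin' : ∀ v ∈ supportVectors S, lorQ v₀ x.1 ≤ lorQ v x.1 := fun v hv => by
    by_cases h : lorQ v x.1 ≤ x.1 0
    · exact hmin ⟨hv, h⟩
    · exact hv₀.2.trans (not_le.1 h).le
  have hK' : IsCompact (supportVectors S ∩ {v | lorQ v x.1 ≤ lorQ v₀ x.1}) := by
    refine hK.of_isClosed_subset (hclosed.inter (isClosed_le (hcont x.1) continuous_const)) ?_
    rintro v ⟨hv, hvx⟩
    exact ⟨hv, show lorQ v x.1 ≤ x.1 0 from le_trans hvx hv₀.2⟩
  -- If `w` vanishes on the contacts of an extreme minimiser `v`, it vanishes at `x`, and moving `v`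
  -- both ways along `w` stays among the minimisers; hence `w = 0`.
  obtain ⟨v, hv, hext⟩ := hK'.extremePoints_nonempty ⟨v₀, hv₀.1, le_refl (lorQ v₀ x.1)⟩
  have hxv := hS.mem_lcone_contacts hn hv.1 fun v' hv' => le_trans hv.2 (hmin' v' hv')
  refine ⟨v, hv.1, hxv, fun w hw => ?_⟩
  have hwx : lorQ w x.1 = 0 := by
    refine le_antisymm ?_ (nonneg_of_mem_lcone (fun t ht => (hw t ht).ge) hxv)
    have := nonneg_of_mem_lcone (g := lorQ (-w)) (fun t ht => by
      rw [map_neg, LinearMap.neg_apply, hw t ht, neg_zero]) hxv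
    simpa using this
  obtain ⟨ε₁, hε₁, h₁, -⟩ := hS.exists_perturbation hn hv.1 (fun t ht => (hw t ht).ge)
  obtain ⟨ε₂, hε₂, h₂, -⟩ := hS.exists_perturbation hn hv.1 (w := -w) fun t ht => by
    rw [map_neg, LinearMap.neg_apply, hw t ht, neg_zero]
  have hmem : ∀ ε : ℝ, lorQ (v + ε • w) x.1 ≤ lorQ v₀ x.1 := fun ε => by
    simpa [hwx] using hv.2
  have hseg : v ∈ openSegment ℝ (v + ε₁ • w) (v + ε₂ • -w) := by
    refine ⟨ε₂ / (ε₁ + ε₂), ε₁ / (ε₁ + ε₂), by positivity, by positivity, by field_simp; ring, ?_⟩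
    have : ε₁ + ε₂ ≠ 0 := by positivity
    ext i
    simp only [Pi.add_apply, Pi.smul_apply, Pi.neg_apply, smul_eq_mul]
    field_simp
    ring
  have := hext ⟨h₁, hmem ε₁⟩ ⟨h₂, by simpa using hmem (-ε₂)⟩ hseg
  rw [add_eq_left, smul_eq_zero] at this
  exact this.resolve_left hε₁.ne'

/-- A cell whose contact points span has full dimension. -/
theorem hDim_coneCell {n : ℕ} {T : Set (Hyp n)} (hne : T.Nonempty)
    (hT : ∀ w, (∀ t ∈ T, lorQ w t.1 = 0) → w = 0) : hDim (coneCell T) = n := by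
  have hset : {k | ∃ W : Submodule ℝ (Fin (n + 1) → ℝ), Module.finrank ℝ W = k + 1 ∧
      (∃ x : Hyp n, x.1 ∈ W) ∧ ∀ x ∈ coneCell T, x.1 ∈ W} = {n} := by
    ext k
    rw [Set.mem_singleton_iff]
    constructor
    · rintro ⟨W, hW, -, hTW⟩
      have htop : W = ⊤ := by
        by_contra h
        obtain ⟨g, hg, hgW⟩ := Submodule.exists_le_ker_of_lt_top W (lt_top_iff_ne_top.2 h)
        obtain ⟨w, rfl⟩ := exists_eq_lorQ g
        refine hg ?_
        rw [hT w fun t ht => hgW (hTW t (subset_coneCell T ht)), map_zero]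
      rw [htop, finrank_top, Module.finrank_fin_fun] at hW
      omega
    · rintro rfl
      obtain ⟨t, -⟩ := hne
      exact ⟨⊤, by rw [finrank_top, Module.finrank_fin_fun], ⟨t, trivial⟩, fun _ _ => trivial⟩
  rw [hDim, hset, csInf_singleton]

theorem sUnion_fullDim_Delaunay {n : ℕ} (hn : 1 ≤ n) {S : Set (Hyp n)} (hS : IsDelone S) :
    ⋃₀ {D | D ∈ Delaunay S ∧ hDim D = n} = Set.univ := by
  refine Set.eq_univ_of_forall fun x => ?_
  obtain ⟨v, hv, hx, hT⟩ := exists_mem_coneCell_spanning hn hS x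
  have hne := contacts_nonempty_of_mem hx x.ne_zero
  exact ⟨_, ⟨(mem_Delaunay_iff hn hS).2 ⟨v, hv, hne, rfl⟩, hDim_coneCell hne hT⟩, hx⟩

theorem isPolyhedralDecomposition_Delaunay {n : ℕ} (hn : 1 ≤ n) {S : Set (Hyp n)}
    (hS : IsDelone S) : IsPolyhedralDecomposition (Delaunay S) := by
  refine ⟨fun C hC => ?_, ?_, fun C hC D hD => mem_Delaunay_of_isHFace hn hS hC hD,
    fun C hC C' hC' hne h => ⟨isHFace_inter hn hS hC hC' hne h, ?_⟩⟩
  · obtain ⟨v, hv, hne, rfl⟩ := (mem_Delaunay_iff hn hS).1 hC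
    exact isHPolyhedron_coneCell (hS.finite_contacts hn hv) hne
  · refine Set.eq_univ_of_forall fun x => ?_
    obtain ⟨D, hD, hx⟩ := Set.mem_sUnion.1 (sUnion_fullDim_Delaunay hn hS ▸ Set.mem_univ x)
    exact ⟨D, hD.1, hx⟩
  · rw [Set.inter_comm] at h ⊢
    exact isHFace_inter hn hS hC' hC hne.symm h

theorem locFinColl_Delaunay {n : ℕ} (hn : 1 ≤ n) {S : Set (Hyp n)} (hS : IsDelone S) :
    LocFinColl (Delaunay S) := by
  intro x
  obtain ⟨C, hC⟩ := hS.net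
  set b := Hyp.base n
  have hfin := (hS.finite (2 * C * (2 * C * (x.1 0 + 1)))).finite_subsets
  refine ⟨{y | y.1 0 < x.1 0 + 1}, IsOpen.mem_nhds (isOpen_lt
    ((continuous_apply 0).comp continuous_subtype_val) continuous_const)
    (show x.1 0 < x.1 0 + 1 by linarith), ?_⟩
  refine ((hfin.image coneCell).preimage Subtype.val_injective.injOn).subset ?_
  rintro ⟨D, hD⟩ ⟨y, hyD, hy⟩
  obtain ⟨v, hv, -, rfl⟩ := (mem_Delaunay_iff hn hS).1 hD
  refine ⟨_, ?_, rfl⟩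
  intro t ht
  refine ⟨ht.1, ?_⟩
  obtain ⟨c, hc⟩ := exists_eq_smul_hyp (hS.lorQ_self_pos hn hv) (hS.time_pos hn hv)
  set m := √(lorQ v v)
  have hm : 0 < m := Real.sqrt_pos.2 (hS.lorQ_self_pos hn hv)
  have hvm : ∀ z, lorQ v z = m * lorQ c.1 z := fun z => by
    rw [hc, map_smul, LinearMap.smul_apply, smul_eq_mul]
  obtain ⟨s, hs, hcs⟩ := hC c
  -- Since `v = m • c`, this bounds the circumradius by the constant of the net. A cell that meets
  -- the neighbourhood therefore has all its contacts in one fixed bounded region.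
  have hmC : 1 ≤ m * C := by
    have h1 := hv s hs
    rw [hvm] at h1
    exact h1.trans (mul_le_mul_of_nonneg_left hcs hm.le)
  have hC0 : 0 < C := by nlinarith
  have hbound : ∀ z : Hyp n, lorQ v z.1 ≤ 1 → lorQ c.1 z.1 ≤ C := fun z hz => by
    rw [hvm] at hz
    exact le_of_mul_le_mul_left (hz.trans hmC) hm
  have hcy := hbound y (lorQ_le_one_of_mem_coneCell hyD)
  have hct := hbound t ht.2.le
  rw [lorQ_comm] at hct
  have h1 := b.futureCausal.lorQ_le hct
  have h2 := b.futureCausal.lorQ_le hcy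
  rw [lorQ_comm, lorQ_base] at h1
  rw [lorQ_comm _ y.1, lorQ_base] at h2
  have hy' : y.1 0 ≤ x.1 0 + 1 := le_of_lt hy
  refine h1.trans (mul_le_mul_of_nonneg_left (h2.trans ?_) (by positivity))
  exact mul_le_mul_of_nonneg_left hy' (by positivity)

/-! ### Empty spheres -/

theorem hdist_lt_iff {n : ℕ} {x c : Hyp n} {r : ℝ} (hr : 0 ≤ r) :
    hdist x c < r ↔ lorQ c.1 x.1 < Real.cosh r := by
  rw [hdist, ← lorQ_eq_neg_lor, lorQ_comm]
  nth_rw 1 [← Real.arcosh_cosh hr]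
  exact Real.arcosh_lt_arcosh (by linarith [c.one_le_lorQ x]) (Real.cosh_pos r)

theorem hdist_eq_iff {n : ℕ} {x c : Hyp n} {r : ℝ} (hr : 0 ≤ r) :
    hdist x c = r ↔ lorQ c.1 x.1 = Real.cosh r := by
  rw [hdist, ← lorQ_eq_neg_lor, lorQ_comm]
  constructor
  · intro h
    rw [← h, Real.cosh_arcosh (c.one_le_lorQ x)]
  · intro h
    rw [h, Real.arcosh_cosh hr]

theorem contacts_smul {n : ℕ} (S : Set (Hyp n)) (c : Hyp n) {r : ℝ} (hr : 0 ≤ r) :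
    contacts S ((Real.cosh r)⁻¹ • c.1) = hsphere c r ∩ S := by
  ext s
  have : lorQ ((Real.cosh r)⁻¹ • c.1) s.1 = 1 ↔ hdist s c = r := by
    rw [hdist_eq_iff hr, map_smul, LinearMap.smul_apply, smul_eq_mul, ← div_eq_inv_mul,
      div_eq_one_iff_eq (Real.cosh_pos r).ne']
  rw [contacts, Set.mem_sep_iff, this, and_comm]
  rfl

theorem smul_mem_supportVectors_iff {n : ℕ} (S : Set (Hyp n)) (c : Hyp n) {r : ℝ} (hr : 0 ≤ r) :
    (Real.cosh r)⁻¹ • c.1 ∈ supportVectors S ↔ Disjoint (hball c r) S := by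
  rw [Set.disjoint_right]
  refine forall₂_congr fun s _ => ?_
  rw [hball, Set.mem_ofPred_eq, hdist_lt_iff hr, not_lt, map_smul, LinearMap.smul_apply,
    smul_eq_mul, ← div_eq_inv_mul, le_div_iff₀ (Real.cosh_pos r), one_mul]

theorem hHull_mem_Delaunay {n : ℕ} (hn : 1 ≤ n) {S : Set (Hyp n)} (hS : IsDelone S)
    {c : Hyp n} {r : ℝ} (hr : 0 < r) (hne : (hsphere c r ∩ S).Nonempty)
    (hd : Disjoint (hball c r) S) : hHull (hsphere c r ∩ S) ∈ Delaunay S := by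
  have hv := (smul_mem_supportVectors_iff S c hr.le).2 hd
  rw [← contacts_smul S c hr.le] at hne ⊢
  rw [hHull_eq_coneCell (hS.finite_contacts hn hv)]
  exact (mem_Delaunay_iff hn hS).2 ⟨_, hv, hne, rfl⟩

/-- Every nonempty contact set is cut out by a plane that is not tangent to the hyperboloid. -/
theorem exists_supportVector_lorQ_self_lt_one {n : ℕ} (hn : 1 ≤ n) {S : Set (Hyp n)}
    (hS : IsDelone S) {v : Fin (n + 1) → ℝ} (hv : v ∈ supportVectors S)
    (hne : (contacts S v).Nonempty) :
    ∃ v' ∈ supportVectors S, contacts S v' = contacts S v ∧ lorQ v' v' < 1 := by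
  obtain ⟨t, ht⟩ := hne
  obtain ⟨c, hc⟩ := exists_eq_smul_hyp (hS.lorQ_self_pos hn hv) (hS.time_pos hn hv)
  have hm : 0 < √(lorQ v v) := Real.sqrt_pos.2 (hS.lorQ_self_pos hn hv)
  have hmle : √(lorQ v v) ≤ 1 := by
    have h1 := ht.2
    have h2 := c.one_le_lorQ t
    have h3 := congrArg (fun u => lorQ u t.1) hc
    simp only [map_smul, LinearMap.smul_apply, smul_eq_mul, h1] at h3
    nlinarith
  rcases hmle.lt_or_eq with hlt | heq
  · refine ⟨v, hv, rfl, ?_⟩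
    rwa [Real.sqrt_lt' one_pos, one_pow] at hlt
  · rw [heq, one_smul] at hc
    subst hc
    -- Here the sphere has radius `0` and the only contact is `c`. Tilting in a space-like direction
    -- orthogonal to `c` gives a sphere of positive radius that touches `S` only at `c`.
    obtain ⟨w, hw, hcw⟩ := c.exists_spacelike_orthogonal hn
    have hz : ∀ s ∈ contacts S c.1, lorQ w s.1 = 0 := fun s hs => by
      rw [← Hyp.eq_of_lorQ_eq_one hs.2, lorQ_comm, hcw]
    obtain ⟨ε, hε, hv', hcon⟩ := hS.exists_perturbation hn hv fun s hs => (hz s hs).ge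
    refine ⟨_, hv', hcon.trans (Set.sep_eq_self_iff_mem_true.2 hz), ?_⟩
    rw [lorQ_add_self, lorQ_smul_smul, map_smul, hcw, c.lorQ_self, smul_zero]
    nlinarith [mul_pos hε hε]

theorem exists_emptySphere_of_mem_Delaunay {n : ℕ} (hn : 1 ≤ n) {S : Set (Hyp n)}
    (hS : IsDelone S) {D : Set (Hyp n)} (hD : D ∈ Delaunay S) :
    ∃ (c : Hyp n) (r : ℝ), 0 < r ∧ (hsphere c r ∩ S).Nonempty ∧
      Disjoint (hball c r) S ∧ D = hHull (hsphere c r ∩ S) := by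
  obtain ⟨v₀, hv₀, hne, rfl⟩ := (mem_Delaunay_iff hn hS).1 hD
  obtain ⟨v, hv, hcon, hlt⟩ := exists_supportVector_lorQ_self_lt_one hn hS hv₀ hne
  rw [← hcon] at hne ⊢
  have hpos := hS.lorQ_self_pos hn hv
  obtain ⟨c, hc⟩ := exists_eq_smul_hyp hpos (hS.time_pos hn hv)
  have hm : 0 < √(lorQ v v) := Real.sqrt_pos.2 hpos
  have hm1 : 1 < (√(lorQ v v))⁻¹ := by
    rw [one_lt_inv₀ hm, Real.sqrt_lt' one_pos, one_pow]
    exact hlt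
  set r := Real.arcosh (√(lorQ v v))⁻¹ with hr
  have hr0 : 0 < r := Real.arcosh_pos hm1
  have hvr : v = (Real.cosh r)⁻¹ • c.1 := by
    rw [hr, Real.cosh_arcosh hm1.le, inv_inv]
    exact hc
  have hfin := hS.finite_contacts hn hv
  rw [← hHull_eq_coneCell hfin]
  rw [hvr] at hv hne ⊢
  rw [contacts_smul S c hr0.le] at hne ⊢
  exact ⟨c, r, hr0, hne, (smul_mem_supportVectors_iff S c hr0.le).1 hv, rfl⟩

/-! ### Orbits of cocompact lattices -/

theorem SOplus.smul_val {n : ℕ} (A : SOplus n) (x : Hyp n) : (A • x).1 = A.1.1.mulVec x.1 := rfl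

theorem SOplus.lorQ_mulVec {n : ℕ} (A : SOplus n) (x y : Fin (n + 1) → ℝ) :
    lorQ (A.1.1.mulVec x) (A.1.1.mulVec y) = lorQ x y := by
  rw [lorQ_eq_neg_lor, A.2.2.1, lorQ_eq_neg_lor]

theorem SOplus.lorQ_smul {n : ℕ} (A : SOplus n) (x y : Hyp n) :
    lorQ (A • x).1 (A • y).1 = lorQ x.1 y.1 :=
  SOplus.lorQ_mulVec A _ _

theorem SOplus.lorQ_inv_smul {n : ℕ} (A : SOplus n) (x y : Hyp n) :
    lorQ (A⁻¹ • x).1 y.1 = lorQ x.1 (A • y).1 := by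
  rw [← SOplus.lorQ_smul A, smul_inv_smul]

instance SOplus.instContinuousConstSMulHyp (n : ℕ) : ContinuousConstSMul (SOplus n) (Hyp n) where
  continuous_const_smul A :=
    Continuous.subtype_mk ((Matrix.mulVecLin A.1.1).continuous_of_finiteDimensional.comp
      continuous_subtype_val) _

instance SOplus.instContinuousConstSMulSubgroupHyp {n : ℕ} (Γ : Subgroup (SOplus n)) :
    ContinuousConstSMul Γ (Hyp n) where
  continuous_const_smul γ := continuous_const_smul γ.1

theorem SOplus.futureCausal_mulVec {n : ℕ} (A : SOplus n) {z : Fin (n + 1) → ℝ}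
    (hz : FutureCausal z) : FutureCausal (A.1.1.mulVec z) :=
  futureCausal_of_forall_nonneg fun p => by
    have := lorQ_nonneg hz (A⁻¹ • p).futureCausal
    rw [← SOplus.lorQ_mulVec A, ← SOplus.smul_val A, smul_inv_smul] at this
    exact this

/-- The entries of an isometry are bounded in terms of the displacement of the base point. -/
theorem SOplus.abs_entry_le {n : ℕ} (A : SOplus n) {M : ℝ} (hM : (A • Hyp.base n).1 0 ≤ M)
    (i j : Fin (n + 1)) : |A.1.1 i j| ≤ 3 * M := by
  have hbase : (A • Hyp.base n).1 = A.1.1.mulVec (Pi.single 0 1) := rfl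
  have h0 := (A • Hyp.base n).futureCausal.abs_apply_le i
  have hpos := (A • Hyp.base n).2.2
  have hcol : ∀ k, A.1.1 i k = A.1.1.mulVec (Pi.single k 1) i := fun k => by simp
  refine Fin.cases ?_ (fun k => ?_) j
  · rw [hcol, ← hbase]
    linarith
  · have hfc : ∀ σ : ℝ, σ * σ = 1 →
        FutureCausal (Pi.single 0 1 + σ • Pi.single k.succ 1 : Fin (n + 1) → ℝ) := fun σ hσ => by
      refine ⟨?_, by simp⟩
      rw [lorQ_apply]
      have : ∀ i : Fin n, (Pi.single 0 1 + σ • Pi.single k.succ 1 : Fin (n + 1) → ℝ) i.succ *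
          (Pi.single 0 1 + σ • Pi.single k.succ 1 : Fin (n + 1) → ℝ) i.succ =
          if i = k then 1 else 0 := fun i => by
        by_cases h : i = k
        · subst h; simp [hσ]
        · have h' : i.succ ≠ k.succ := fun e => h (Fin.succ_injective _ e)
          simp [h]
      simp only [this]
      simp
    have h1 := SOplus.futureCausal_mulVec A (hfc 1 (by norm_num))
    have h2 := SOplus.futureCausal_mulVec A (hfc (-1) (by norm_num))
    have e1 := h1.abs_apply_le i
    have n2 := h2.2
    rw [Matrix.mulVec_add, Matrix.mulVec_smul, ← hbase] at e1 n2
    simp only [Pi.add_apply, Pi.smul_apply, smul_eq_mul] at e1 n2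
    rw [hcol]
    rw [abs_le] at e1 h0 ⊢
    constructor <;> linarith

/-- A discrete group of isometries has only finitely many elements moving a point a bounded
amount. -/
theorem finite_smul_time_le {n : ℕ} {Γ : Subgroup (SOplus n)} [DiscreteTopology Γ] (x : Hyp n)
    (M : ℝ) : {γ ∈ (Γ : Set (SOplus n)) | (γ • x).1 0 ≤ M}.Finite := by
  let Γ' : Subgroup (GL (Fin (n + 1)) ℝ) := Γ.map (SOplus n).subtype
  have hΓ' : DiscreteTopology Γ' := by
    let φ : Γ → Γ' := fun γ => ⟨γ.1.1, γ.1, γ.2, rfl⟩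
    have hemb : Topology.IsInducing φ := by
      refine (Topology.IsInducing.of_comp_iff (f := φ)
        (g := (Subtype.val : Γ' → GL (Fin (n + 1)) ℝ)) Topology.IsInducing.subtypeVal).1 ?_
      exact Topology.IsInducing.comp (f := (Subtype.val : Γ → SOplus n))
        (g := (Subtype.val : SOplus n → GL (Fin (n + 1)) ℝ))
        Topology.IsInducing.subtypeVal Topology.IsInducing.subtypeVal
    have hsurj : Function.Surjective φ := by
      rintro ⟨_, γ, hγ, rfl⟩
      exact ⟨⟨γ, hγ⟩, rfl⟩
    have hinj : Function.Injective φ := fun a b h =>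
      Subtype.ext (Subtype.ext (congrArg (fun g : Γ' => (g : GL (Fin (n + 1)) ℝ)) h))
    exact (Equiv.ofBijective φ ⟨hinj, hsurj⟩ |>.toHomeomorphOfIsInducing hemb).discreteTopology
  set b := Hyp.base n
  set R := 3 * (2 * lorQ b.1 x.1 * M)
  let B : Set (Matrix (Fin (n + 1)) (Fin (n + 1)) ℝ) :=
    Set.univ.pi fun _ => Set.univ.pi fun _ => Set.Icc (-R) R
  have hB : IsCompact B := isCompact_univ_pi fun _ => isCompact_univ_pi fun _ => isCompact_Icc
  -- The topology of the unit group records a matrix together with its inverse, so both must be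
  -- bounded; `γ` and `γ⁻¹` displace the base point equally.
  have hK : IsCompact ((Units.embedProduct (Matrix (Fin (n + 1)) (Fin (n + 1)) ℝ)) ⁻¹'
      (B ×ˢ (MulOpposite.unop ⁻¹' B))) :=
    Units.isClosedEmbedding_embedProduct.isCompact_preimage
      (hB.prod (MulOpposite.opHomeomorph.symm.isClosedEmbedding.isCompact_preimage hB))
  have hfin : ((Γ' : Set (GL (Fin (n + 1)) ℝ)) ∩
      (Units.embedProduct (Matrix (Fin (n + 1)) (Fin (n + 1)) ℝ)) ⁻¹'
      (B ×ˢ (MulOpposite.unop ⁻¹' B))).Finite := by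
    have hcl : IsClosed (Γ' : Set (GL (Fin (n + 1)) ℝ)) := Subgroup.isClosed_of_discrete
    refine (hK.inter_left hcl).finite ?_
    exact ⟨DiscreteTopology.of_subset hΓ' Set.inter_subset_left⟩
  refine (hfin.preimage (f := Subtype.val) Subtype.val_injective.injOn).subset ?_
  rintro γ ⟨hγ, hγx⟩
  have h1 : (γ • b).1 0 ≤ 2 * lorQ b.1 x.1 * M := by
    have h2 := b.futureCausal.lorQ_le (SOplus.lorQ_smul γ b x).le
    rw [lorQ_comm b.1 (γ • b).1, lorQ_base, lorQ_comm b.1 (γ • x).1, lorQ_base] at h2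
    refine h2.trans (mul_le_mul_of_nonneg_left hγx ?_)
    linarith [b.one_le_lorQ x]
  have h2 : (γ⁻¹ • b).1 0 ≤ 2 * lorQ b.1 x.1 * M := by
    rw [← lorQ_base (γ⁻¹ • b).1, SOplus.lorQ_inv_smul γ, lorQ_comm, lorQ_base]
    exact h1
  refine ⟨⟨γ, hγ, rfl⟩, ?_, ?_⟩
  · intro i _ j _
    exact abs_le.1 (SOplus.abs_entry_le γ h1 i j)
  · intro i _ j _
    exact abs_le.1 (SOplus.abs_entry_le γ⁻¹ h2 i j)

/-- The quotient map is open, so the images of the sublevel sets of the time coordinate form an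
increasing open cover of a compact space. -/
theorem exists_smul_time_lt {n : ℕ} {Γ : Subgroup (SOplus n)}
    [CompactSpace (MulAction.orbitRel.Quotient Γ (Hyp n))] :
    ∃ k : ℝ, ∀ x : Hyp n, ∃ γ ∈ Γ, (γ • x).1 0 < k := by
  have hopen : ∀ k : ℕ, IsOpen (quotProj Γ '' {x : Hyp n | x.1 0 < k}) := fun k =>
    isOpenMap_quotient_mk'_mul _ (isOpen_lt ((continuous_apply 0).comp continuous_subtype_val)
      continuous_const)
  obtain ⟨t, ht⟩ := isCompact_univ.elim_finite_subcover _ hopen (by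
    rintro ⟨x⟩ -
    obtain ⟨k, hk⟩ := exists_nat_gt (x.1 0)
    exact Set.mem_iUnion.2 ⟨k, x, hk, rfl⟩)
  refine ⟨(t.sup id : ℕ), fun x => ?_⟩
  obtain ⟨k, hk, y, hy, hyx⟩ := Set.mem_iUnion₂.1 (ht (Set.mem_univ (quotProj Γ x)))
  obtain ⟨γ, hγ⟩ := MulAction.orbitRel_apply.1 (Quotient.exact hyx)
  refine ⟨γ.1, γ.2, ?_⟩
  have h1 : γ.1 • x = y := hγ
  rw [h1]
  refine lt_of_lt_of_le hy ?_
  exact_mod_cast Finset.le_sup (f := id) hk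

/-- A nonempty invariant set consisting of finitely many orbits of a cocompact lattice is a
Delone set. -/
theorem isDelone_of_isCocompactLattice {n : ℕ} {Γ : Subgroup (SOplus n)}
    (hΓ : IsCocompactLattice Γ) {S : Set (Hyp n)} (hne : S.Nonempty)
    (hinv : ∀ γ ∈ Γ, ∀ x ∈ S, γ • x ∈ S) (hfin : (quotProj Γ '' S).Finite) : IsDelone S := by
  obtain ⟨hd, hc⟩ := hΓ
  constructor
  · obtain ⟨k, hk⟩ := exists_smul_time_lt (Γ := Γ)
    obtain ⟨s, hs⟩ := hne
    refine ⟨2 * lorQ (Hyp.base n).1 s.1 * k, fun x => ?_⟩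
    obtain ⟨γ, hγ, hx⟩ := hk x
    refine ⟨γ⁻¹ • s, hinv _ (Γ.inv_mem hγ) s hs, ?_⟩
    rw [lorQ_comm, SOplus.lorQ_inv_smul γ, lorQ_comm]
    have h1 := (γ • x).futureCausal.lorQ_le
      (show lorQ s.1 (Hyp.base n).1 ≤ lorQ (Hyp.base n).1 s.1 by rw [lorQ_comm])
    rw [lorQ_base] at h1
    refine h1.trans (mul_le_mul_of_nonneg_left hx.le ?_)
    linarith [(Hyp.base n).one_le_lorQ s]
  · intro M
    -- `F` holds one representative of each orbit; each orbit has finitely many points in a bounded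
    -- region by discreteness.
    obtain ⟨F, -, hbij⟩ := Set.exists_subset_bijOn S (quotProj Γ)
    have hF : F.Finite := hbij.finite_iff_finite.2 hfin
    refine (hF.biUnion fun x _ => (finite_smul_time_le (Γ := Γ) x M).image
      fun γ => γ • x).subset ?_
    rintro s ⟨hs, hsM⟩
    obtain ⟨x, hx, hxs⟩ : quotProj Γ s ∈ quotProj Γ '' F := hbij.image_eq ▸ ⟨s, hs, rfl⟩
    obtain ⟨γ, hγ⟩ := MulAction.orbitRel_apply.1 (Quotient.exact hxs.symm)
    have h1 : γ.1 • x = s := hγ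
    refine Set.mem_biUnion hx ⟨γ.1, ⟨γ.2, ?_⟩, h1⟩
    rw [h1]
    exact hsM

/-! ### Invariance and the main theorem -/

/-- The Delaunay tessellation of an invariant set is invariant. -/
theorem smul_mem_Delaunay {n : ℕ} (hn : 1 ≤ n) {Γ : Subgroup (SOplus n)} {S : Set (Hyp n)}
    (hS : IsDelone S) (hinv : ∀ γ ∈ Γ, ∀ x ∈ S, γ • x ∈ S) {γ : SOplus n} (hγ : γ ∈ Γ)
    {D : Set (Hyp n)} (hD : D ∈ Delaunay S) : (fun x => γ • x) '' D ∈ Delaunay S := by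
  obtain ⟨v, hv, ⟨t, ht⟩, rfl⟩ := (mem_Delaunay_iff hn hS).1 hD
  have hq : ∀ s : Hyp n, lorQ (γ.1.1.mulVec v) s.1 = lorQ v (γ⁻¹ • s).1 := fun s => by
    rw [← SOplus.lorQ_mulVec γ v, ← SOplus.smul_val, smul_inv_smul]
  have hmap : ∀ (A : SOplus n) {T T' : Set (Hyp n)}, (∀ t ∈ T, A • t ∈ T') →
      ∀ x ∈ coneCell T, A • x ∈ coneCell T' := by
    intro A T T' hT x hx
    refine lcone_induction (p := fun x => A.1.1.mulVec x ∈ lcone T')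
      (fun t ht => mem_lcone_of_mem (hT t ht)) ?_ (fun x y hx hy => ?_) (fun a x ha hx => ?_) hx
    · rw [Matrix.mulVec_zero]; exact zero_mem _
    · rw [Matrix.mulVec_add]; exact add_mem hx hy
    · rw [Matrix.mulVec_smul]; exact smul_mem_lcone hx ha.le
  have hto : ∀ t ∈ contacts S v, γ • t ∈ contacts S (γ.1.1.mulVec v) := fun t ht =>
    ⟨hinv γ hγ t ht.1, by rw [hq, inv_smul_smul]; exact ht.2⟩
  have hfrom : ∀ t ∈ contacts S (γ.1.1.mulVec v), γ⁻¹ • t ∈ contacts S v := fun t ht =>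
    ⟨hinv _ (Γ.inv_mem hγ) t ht.1, by rw [← hq]; exact ht.2⟩
  refine (mem_Delaunay_iff hn hS).2 ⟨γ.1.1.mulVec v, fun s hs => ?_, ⟨_, hto t ht⟩, ?_⟩
  · rw [hq]
    exact hv _ (hinv _ (Γ.inv_mem hγ) s hs)
  · ext y
    constructor
    · rintro ⟨x, hx, rfl⟩
      exact hmap γ hto x hx
    · intro hy
      exact ⟨γ⁻¹ • y, hmap γ⁻¹ hfrom y hy, smul_inv_smul γ y⟩

theorem mainTheorem5 (n : ℕ) (hn : 1 ≤ n) (Γ : Subgroup (SOplus n))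
    (hΓ : IsCocompactLattice Γ) (htf : IsTorsionFreeGroup Γ)
    (S : Set (Hyp n)) (hne : S.Nonempty) (hinv : ∀ γ ∈ Γ, ∀ x ∈ S, γ • x ∈ S)
    (hfin : (quotProj Γ '' S).Finite) :
    -- the Delaunay tessellation is a locally finite, invariant polyhedral decomposition
    IsPolyhedralDecomposition (Delaunay S) ∧
    LocFinColl (Delaunay S) ∧
    (∀ γ ∈ Γ, ∀ D ∈ Delaunay S, (fun x => γ • x) '' D ∈ Delaunay S) ∧
    -- it is the union of its n-cells
    ⋃₀ {D | D ∈ Delaunay S ∧ hDim D = n} = Set.univ ∧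
    -- empty metric spheres give cells
    (∀ (c : Hyp n) (r : ℝ), 0 < r → (hsphere c r ∩ S).Nonempty → Disjoint (hball c r) S →
      hHull (hsphere c r ∩ S) ∈ Delaunay S) ∧
    -- each cell has this form
    (∀ D ∈ Delaunay S, ∃ (c : Hyp n) (r : ℝ), 0 < r ∧ (hsphere c r ∩ S).Nonempty ∧
      Disjoint (hball c r) S ∧ D = hHull (hsphere c r ∩ S)) := by
  have hS := isDelone_of_isCocompactLattice hΓ hne hinv hfin
  exact ⟨isPolyhedralDecomposition_Delaunay hn hS, locFinColl_Delaunay hn hS,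
    fun γ hγ D hD => smul_mem_Delaunay hn hS hinv hγ hD, sUnion_fullDim_Delaunay hn hS,
    fun c r hr hne' hd => hHull_mem_Delaunay hn hS hr hne' hd,
    fun D hD => exists_emptySphere_of_mem_Delaunay hn hS hD⟩
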